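/- All graphs are finite and simple. For a graph $G=(V,E)$, a matching is a set of pairwise non-adjacent edges; $\nu(G)$ is the maximum size of a matching; $\lambda(G)$ is the maximum of $|H|+|H'|$ over pairs $(H,H')$ of disjoint matchings; $\Lambda(G)$ is the set of pairs of disjoint matchings with $|H|+|H'|=\lambda(G)$; and $\mu(G)=\max\{|H| : (H,H')\in\Lambda(G)\}$. Call a triple $(M,H,H')$ admissible if $M$ is a matching with $|M|=\nu(G)$, $(H,H')\in\Lambda(G)$ and $|H|=\mu(G)$. A triple is \emph{maximally intersecting} if it is admissible, $|M\cap(H\cup H')|$ is maximum among all admissible triples, and $|M\cap H|$ is maximum among all admissible triples that maximize $|M\cap(H\cup H')|$. A path is odd (even) if it has an odd (even) number of edges; an isolated vertex is an even path. An $A$, $B$ alternating path (cycle) is one whose edges lie alternately in $A\setminus B$ and $B\setminus A$; it is nontrivial if it has at least one edge. The odd edges of an odd path are its first, third, fifth, $\dots$, last edges. A connected nonempty graph $G$ is a \emph{skeleton} if all its degrees are at most $3$ and it has a (not necessarily spanning) subgraph $G'=(V',E')$ such that 1. the connected components of $G'$ are odd paths of length at least $5$ whose end-vertices have degree $1$ in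 $G$; 2. for each odd edge of a path of $G'$, either both of its endpoints have degree $3$ in $G$ (such an edge is called rich) or neither has; 3. each path of $G'$ contains a vertex of degree $3$ in $G$; 4. every vertex in $V\setminus V'$ has degree at most $2$ in $G$; 5. every connected component of $G-V'$ is an odd path; 6. in the graph $G''$ obtained from $G$ by deleting the rich edges, the connected component of each end-vertex of a path of $G'$ is an even path, and these are the only connected components of $G''$ that are even paths; 7. $G''$ is bipartite; 8. if $N$ is the matching consisting of all odd edges of the paths of $G'$ and all odd edges of the paths of $G-V'$, then $G$ has no $N$, $E\setminus N$ alternating cycle. It is a \emph{$k$-skeleton} if such a $G'$ with exactly $k$ connected components exists. **Theorem.** Let $G=(V,E)$ be a finite connected graph with at least one edge and $\dfrac{\mu(G)}{\nu(G)}<1$. Then some maximally intersecting triple $(M,H,H')$ satisfies $E=M\cup H\cup H'$ if and only if every maximally intersecting triple does. If this is the case, then $G$ is a skeleton, and in fact a $(\nu(G)-\mu(G))$-skeleton. Moreover, for every maximally intersecting triple $(M,H,H')$, the union $G'$ of all nontrivial $M$, $H$ alternating paths in $G$ satisfies conditions 1--8 and has exactly $\nu(G)-\mu(G)$ connected components.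 -/

import Mathlib

namespace DisjointMatchings

variable {V : Type*}

/-! ### Matchings and the parameters of a finite graph -/

/-- A matching of `G`: a (finite) set of edges of `G`, no two of which share a vertex. -/
def IsMatching (G : SimpleGraph V) (M : Finset (Sym2 V)) : Prop :=
  (∀ e ∈ M, e ∈ G.edgeSet) ∧ ∀ e ∈ M, ∀ f ∈ M, ∀ x : V, x ∈ e → x ∈ f → e = f

/-- A pair of disjoint matchings of `G`. -/
def IsDisjointPair (G : SimpleGraph V) (H H' : Finset (Sym2 V)) : Prop :=
  IsMatching G H ∧ IsMatching G H' ∧ Disjoint H H'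

/-- `ν(G)`: the maximum size of a matching. (For finite `V` the set is nonempty and bounded,
so that the supremum is a maximum; likewise for `lam` and `mu` below.) -/
noncomputable def nu (G : SimpleGraph V) : ℕ :=
  sSup {n | ∃ M, IsMatching G M ∧ M.card = n}

/-- `λ(G)`: the maximum of `|H| + |H'|` over pairs of disjoint matchings. -/
noncomputable def lam (G : SimpleGraph V) : ℕ :=
  sSup {n | ∃ H H', IsDisjointPair G H H' ∧ H.card + H'.card = n}

/-- `(H, H') ∈ Λ(G)`. -/
def InLambda (G : SimpleGraph V) (H H' : Finset (Sym2 V)) : Prop :=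
  IsDisjointPair G H H' ∧ H.card + H'.card = lam G

/-- `μ(G)`: the maximum of `|H|` over the pairs `(H, H') ∈ Λ(G)`. -/
noncomputable def mu (G : SimpleGraph V) : ℕ :=
  sSup {n | ∃ H H', InLambda G H H' ∧ H.card = n}

/-- `(H, H') ∈ Λ_μ(G)`. -/
def InLambdaMu (G : SimpleGraph V) (H H' : Finset (Sym2 V)) : Prop :=
  InLambda G H H' ∧ H.card = mu G

/-! ### Maximally intersecting triples -/

/-- `M` is a maximum matching and `(H, H') ∈ Λ_μ(G)`. -/
def IsAdmissible (G : SimpleGraph V) (M H H' : Finset (Sym2 V)) : Prop :=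
  (IsMatching G M ∧ M.card = nu G) ∧ InLambdaMu G H H'

/-- An admissible triple for which `|M ∩ (H ∪ H')|` is maximum among all admissible triples. -/
def IsUnionMaximal [DecidableEq V] (G : SimpleGraph V) (M H H' : Finset (Sym2 V)) : Prop :=
  IsAdmissible G M H H' ∧
    ∀ N K K', IsAdmissible G N K K' → (N ∩ (K ∪ K')).card ≤ (M ∩ (H ∪ H')).card

/-- Maximally intersecting triples: `|M ∩ H|` is maximum among all the triples of
`IsUnionMaximal`. -/
def IsMaximallyIntersecting [DecidableEq V] (G : SimpleGraph V)
    (M H H' : Finset (Sym2 V)) : Prop :=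
  IsUnionMaximal G M H H' ∧
    ∀ N K K', IsUnionMaximal G N K K' → (N ∩ K).card ≤ (M ∩ H).card

/-- `E = M ∪ H ∪ H'`. -/
def Covers (G : SimpleGraph V) (M H H' : Finset (Sym2 V)) : Prop :=
  G.edgeSet = (M : Set (Sym2 V)) ∪ H ∪ H'

/-! ### Alternating paths and cycles -/

/-- A list of edges that lie alternately in `A \ B` and in `B \ A`. -/
def IsAlternating (A B : Set (Sym2 V)) (l : List (Sym2 V)) : Prop :=
  (∀ e ∈ l, e ∈ A \ B ∨ e ∈ B \ A) ∧ l.IsChain (fun e f => e ∈ A ↔ f ∈ B)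

/-- An `A`, `B` alternating path in `G`. -/
def IsAlternatingPath {G : SimpleGraph V} (A B : Set (Sym2 V)) {u v : V} (p : G.Walk u v) :
    Prop :=
  p.IsPath ∧ IsAlternating A B p.edges

/-- An `A`, `B` alternating cycle in `G`. Evenness of the length says that the alternation also
holds between the last and the first edge. -/
def IsAlternatingCycle {G : SimpleGraph V} (A B : Set (Sym2 V)) {u : V} (c : G.Walk u u) :
    Prop :=
  c.IsCycle ∧ IsAlternating A B c.edges ∧ Even c.length

/-- The union of all nontrivial (that is, having at least one edge) `A`, `B` alternating
paths in `G`, as a subgraph of `G`. -/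
def alternatingUnion (G : SimpleGraph V) (A B : Set (Sym2 V)) : G.Subgraph :=
  sSup {K | ∃ (u v : V) (p : G.Walk u v),
    IsAlternatingPath A B p ∧ 0 < p.length ∧ K = p.toSubgraph}

/-! ### Skeletons -/

/-- The path `p` is a whole connected component of the subgraph `K` of `G`: it lies in `K`, and
every edge of `K` at a vertex of `p` is an edge of `p`. In a disjoint union of paths these are
exactly the maximal paths. A path of length `0` is an isolated vertex of `K`. -/
def IsPathComponent {G : SimpleGraph V} (K : G.Subgraph) {u v : V} (p : G.Walk u v) : Prop :=
  p.IsPath ∧ p.toSubgraph ≤ K ∧ ∀ x ∈ p.support, ∀ y, K.Adj x y → s(x, y) ∈ p.edges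

/-- `e` is the first, third, fifth, ... edge of `p`, i.e. its edge-distance from the first
end-edge is even. On a path of odd length this does not depend on the direction. -/
def IsOddEdge {G : SimpleGraph V} {u v : V} (p : G.Walk u v) (e : Sym2 V) : Prop :=
  ∃ i : ℕ, Even i ∧ p.edges[i]? = some e

/-- The set of odd edges of the path components of `K`. -/
def oddEdges {G : SimpleGraph V} (K : G.Subgraph) : Set (Sym2 V) :=
  {e | ∃ (u v : V) (p : G.Walk u v), IsPathComponent K p ∧ IsOddEdge p e}

/-- `x` is an end-vertex of a path component of `K`. -/
def IsEndVertex {G : SimpleGraph V} (K : G.Subgraph) (x : V) : Prop :=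
  ∃ (u v : V) (p : G.Walk u v), IsPathComponent K p ∧ (x = u ∨ x = v)

/-- `K` consists of vertex-disjoint odd paths: each vertex of `K` lies on a component of `K`
that is a path of odd length. -/
def ConsistsOfOddPaths {G : SimpleGraph V} (K : G.Subgraph) : Prop :=
  ∀ x ∈ K.verts, ∃ (u v : V) (p : G.Walk u v),
    IsPathComponent K p ∧ x ∈ p.support ∧ Odd p.length

section Skeleton

variable [Fintype V] (G : SimpleGraph V) [DecidableRel G.Adj]

/-- The rich edges: odd edges of the paths of `G'` whose vertices both have `G`-degree `3`. -/
def richEdges (G' : G.Subgraph) : Set (Sym2 V) :=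
  {e | e ∈ oddEdges G' ∧ ∀ x ∈ e, G.degree x = 3}

/-- `G - V'`, where `V'` is the vertex set of `G'`. -/
def complementPart (G' : G.Subgraph) : G.Subgraph :=
  (⊤ : G.Subgraph).deleteVerts G'.verts

/-- `G''`: the spanning subgraph of `G` obtained by removing the rich edges. -/
def poorPart (G' : G.Subgraph) : G.Subgraph :=
  (⊤ : G.Subgraph).deleteEdges (richEdges G G')

/-- The matching formed by the odd edges of the paths of `G'` and of `G - V'`. -/
def skeletonMatching (G' : G.Subgraph) : Set (Sym2 V) :=
  oddEdges G' ∪ oddEdges (complementPart G G')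

/-- The subgraph `G'` witnesses that `G` is a skeleton. -/
structure IsSkeletonWitness (G' : G.Subgraph) : Prop where
  /-- `G'` consists of vertex-disjoint odd paths of length at least `5` between leaves of `G`. -/
  paths : ∀ x ∈ G'.verts, ∃ (u v : V) (p : G.Walk u v), IsPathComponent G' p ∧ x ∈ p.support ∧
    Odd p.length ∧ 5 ≤ p.length ∧ G.degree u = 1 ∧ G.degree v = 1
  /-- Both or none of the vertices of an odd edge of a path of `G'` have `G`-degree `3`. -/
  odd_edges : ∀ e ∈ oddEdges G', (∀ x ∈ e, G.degree x = 3) ∨ (∀ x ∈ e, G.degree x ≠ 3)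
  /-- Each path of `G'` contains a vertex of `G`-degree `3`. -/
  three_vertex : ∀ (u v : V) (p : G.Walk u v), IsPathComponent G' p →
    ∃ x ∈ p.support, G.degree x = 3
  /-- Vertices outside `G'` have `G`-degree at most `2`. -/
  degree_compl : ∀ x, x ∉ G'.verts → G.degree x ≤ 2
  /-- `G - V'` consists of vertex-disjoint odd paths. -/
  compl_paths : ConsistsOfOddPaths (complementPart G G')
  /-- The component in `G''` of each end-vertex of a path of `G'` is an even path. -/
  end_vertex : ∀ x, IsEndVertex G' x → ∃ (a b : V) (q : G.Walk a b),
    IsPathComponent (poorPart G G') q ∧ x ∈ q.support ∧ Even q.length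
  /-- No other component of `G''` is an even path. -/
  even_path : ∀ (a b : V) (q : G.Walk a b), IsPathComponent (poorPart G G') q →
    Even q.length → ∃ x ∈ q.support, IsEndVertex G' x
  /-- `G''` is bipartite. -/
  bipartite : (poorPart G G').spanningCoe.IsBipartite
  /-- `G` has no `M`, `Mᶜ` alternating cycle for the matching `M` of odd edges. -/
  no_cycle : ∀ (a : V) (c : G.Walk a a),
    ¬ IsAlternatingCycle (skeletonMatching G G') (G.edgeSet \ skeletonMatching G G') c

/-- A skeleton: a connected nonempty graph with all degrees at most `3` that admits a witness
`G'`. (`SimpleGraph.Connected` includes non-emptiness.) -/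
def IsSkeleton : Prop :=
  G.Connected ∧ (∀ x, G.degree x ≤ 3) ∧ ∃ G' : G.Subgraph, IsSkeletonWitness G G'

/-- A `k`-skeleton: a skeleton with a witness `G'` that has exactly `k` connected components. -/
def IsKSkeleton (k : ℕ) : Prop :=
  G.Connected ∧ (∀ x, G.degree x ≤ 3) ∧
    ∃ G' : G.Subgraph, IsSkeletonWitness G G' ∧ Nat.card G'.coe.ConnectedComponent = k

end Skeleton

end DisjointMatchings

set_option linter.unusedSectionVars false

/-! The proof works by exchange. If no edge of `M` leaves a vertex set `S`, the edges of `M` inside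
`S` may be replaced by those of another matching, and each maximality condition then bounds what can
happen on `S`. Maximality of `|H|` in Λ gives: where neither `H` nor `H'` leaves `S`, `H'` is not
larger than `H`. Maximality of the two intersections gives: if replacing `M` by `H` on `S` costs no
edges, then `M` and `H` already agree on `S`; if replacing it by some matching inside `H ∪ H'` costs
none, then `M` already lies in `H ∪ H'` there.

Applied to components of the symmetric difference of `M` and `H`, this leaves only odd paths that
begin and end in `M` (`isPathSystem`). An `M`-edge outside `H ∪ H'` has both ends covered by `H` and
by `H'` (`exchange_false`). Each path has such an edge, since otherwise `H'` would be larger than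
`H` on it (`exists_edge_notMem`). The end-vertices are missed by `H`, so this edge is not an
end-edge and the path has at least five edges.

Suppose now that the triple covers `E`. Degrees can be read off: an `M`-edge outside `H ∪ H'` has
ends of degree 3, every other `M`-edge has ends of degree at most 2, and the path ends have degree
1. So the rich edges are those of `M` outside `H ∪ H'`, and `G''` is the union of two disjoint
matchings, hence bipartite. Connectedness gives the rest: in each forbidden configuration, `M`, `H`
and `H'` are all confined to one vertex set, which is then all of `V`, and this forces `M ⊆ H` or a
perfect `H`, against `μ < ν`. Thus `M` is perfect, `G - V'` consists of odd paths, and there is no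
alternating cycle.

Finally, `|M ∪ H ∪ H'| = ν + λ - |M ∩ (H ∪ H')|` is the same for all maximally intersecting triples,
so all or none of them cover `E`. Each path has one more edge in `M` than in `H`, so there are `ν -
μ` paths. -/

namespace DisjointMatchings

/-! ### Matchings, covered vertices and exchanges on a vertex set -/

section Matchings

variable {V : Type*} [DecidableEq V] {G : SimpleGraph V}

/-- The vertices covered by a set of edges. -/
def cover (A : Finset (Sym2 V)) : Finset V := A.biUnion Sym2.toFinset

/-- No edge of `A` leaves `S`. -/
def IsClosedUnder (S : Finset V) (A : Finset (Sym2 V)) : Prop :=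
  ∀ e ∈ A, ∀ x ∈ e, ∀ y ∈ e, x ∈ S → y ∈ S

/-- Replace the edges of `A` inside `S` by the edges of `B` inside `S`. -/
def swap (A B : Finset (Sym2 V)) (S : Finset V) : Finset (Sym2 V) :=
  (A \ S.sym2) ∪ (B ∩ S.sym2)

/-- The edges of the list lie alternately in `A \ B` and `B \ A`, beginning with `A \ B`. -/
def Alt : Finset (Sym2 V) → Finset (Sym2 V) → List (Sym2 V) → Prop
  | _, _, [] => True
  | A, B, e :: l => e ∈ A ∧ e ∉ B ∧ Alt B A l

theorem IsMatching.eq_of_mem {A : Finset (Sym2 V)} (hA : IsMatching G A) {e f : Sym2 V} {x : V}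
    (he : e ∈ A) (hf : f ∈ A) (hx : x ∈ e) (hx' : x ∈ f) : e = f :=
  hA.2 e he f hf x hx hx'

theorem IsMatching.subset {A B : Finset (Sym2 V)} (hA : IsMatching G A) (h : B ⊆ A) :
    IsMatching G B :=
  ⟨fun e he => hA.1 e (h he), fun e he f hf => hA.2 e (h he) f (h hf)⟩

theorem mem_cover {A : Finset (Sym2 V)} {x : V} : x ∈ cover A ↔ ∃ e ∈ A, x ∈ e := by
  simp [cover]

theorem cover_mono {A B : Finset (Sym2 V)} (h : A ⊆ B) : cover A ⊆ cover B :=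
  Finset.biUnion_subset_biUnion_of_subset_left _ h

theorem IsMatching.card_cover {A : Finset (Sym2 V)} (hA : IsMatching G A) :
    (cover A).card = 2 * A.card := by
  rw [cover, Finset.card_biUnion, Finset.sum_congr rfl (g := fun _ => 2)]
  · simp [mul_comm]
  · intro e he
    exact Sym2.card_toFinset_of_not_isDiag e (G.not_isDiag_of_mem_edgeSet (hA.1 e he))
  · intro e he f hf hne
    rw [Function.onFun, Finset.disjoint_left]
    intro x hx hx'
    rw [Sym2.mem_toFinset] at hx hx'
    exact hne (hA.eq_of_mem he hf hx hx')

theorem IsClosedUnder.mem_sym2 {S : Finset V} {A : Finset (Sym2 V)} (h : IsClosedUnder S A)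
    {e : Sym2 V} {x : V} (he : e ∈ A) (hx : x ∈ e) (hxS : x ∈ S) : e ∈ S.sym2 :=
  Finset.mem_sym2_iff.2 fun y hy => h e he x hx y hy hxS

theorem IsClosedUnder.mono {S : Finset V} {A B : Finset (Sym2 V)} (h : IsClosedUnder S A)
    (hB : B ⊆ A) : IsClosedUnder S B :=
  fun e he => h e (hB he)

theorem cover_inter_sym2_subset (A : Finset (Sym2 V)) (S : Finset V) :
    cover (A ∩ S.sym2) ⊆ S := by
  intro x hx
  obtain ⟨e, he, hx⟩ := mem_cover.1 hx
  exact Finset.mem_sym2_iff.1 (Finset.mem_inter.1 he).2 x hx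

theorem IsMatching.two_mul_card_le {A : Finset (Sym2 V)} (hA : IsMatching G A) (S : Finset V) :
    2 * (A ∩ S.sym2).card ≤ S.card := by
  rw [← (hA.subset Finset.inter_subset_left).card_cover]
  exact Finset.card_le_card (cover_inter_sym2_subset A S)

theorem IsClosedUnder.cover_inter {S : Finset V} {A : Finset (Sym2 V)} (h : IsClosedUnder S A) :
    cover (A ∩ S.sym2) = cover A ∩ S := by
  ext x
  rw [Finset.mem_inter, mem_cover, mem_cover]
  constructor
  · rintro ⟨e, he, hx⟩
    rw [Finset.mem_inter] at he
    exact ⟨⟨e, he.1, hx⟩, Finset.mem_sym2_iff.1 he.2 x hx⟩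
  · rintro ⟨⟨e, he, hx⟩, hxS⟩
    exact ⟨e, Finset.mem_inter.2 ⟨he, h.mem_sym2 he hx hxS⟩, hx⟩

theorem IsMatching.two_mul_card_eq {A : Finset (Sym2 V)} (hA : IsMatching G A) {S : Finset V}
    (h : IsClosedUnder S A) : 2 * (A ∩ S.sym2).card = (cover A ∩ S).card := by
  rw [← (hA.subset Finset.inter_subset_left).card_cover, h.cover_inter]

theorem mem_swap {A B : Finset (Sym2 V)} {S : Finset V} {e : Sym2 V} :
    e ∈ swap A B S ↔ e ∈ A ∧ e ∉ S.sym2 ∨ e ∈ B ∧ e ∈ S.sym2 := by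
  rw [swap, Finset.mem_union, Finset.mem_sdiff, Finset.mem_inter]

theorem IsMatching.swap {A B : Finset (Sym2 V)} {S : Finset V} (hA : IsMatching G A)
    (hB : IsMatching G B) (h : IsClosedUnder S A) : IsMatching G (swap A B S) := by
  refine ⟨fun e he => ?_, fun e he f hf x hx hx' => ?_⟩
  · rcases mem_swap.1 he with he | he
    exacts [hA.1 e he.1, hB.1 e he.1]
  · rcases mem_swap.1 he with he | he <;> rcases mem_swap.1 hf with hf | hf
    · exact hA.eq_of_mem he.1 hf.1 hx hx'
    · exact absurd (h.mem_sym2 he.1 hx (Finset.mem_sym2_iff.1 hf.2 x hx')) he.2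
    · exact absurd (h.mem_sym2 hf.1 hx' (Finset.mem_sym2_iff.1 he.2 x hx)) hf.2
    · exact hB.eq_of_mem he.1 hf.1 hx hx'

/-- The set `X` will be `H ∪ H'` or `H`, the two sets whose intersection with `M` is maximized. The
additive form avoids truncated subtraction. -/
theorem card_swap_inter (A B X : Finset (Sym2 V)) (S : Finset V) :
    (swap A B S ∩ X).card + (A ∩ S.sym2 ∩ X).card = (A ∩ X).card + (B ∩ S.sym2 ∩ X).card := by
  have h1 : swap A B S ∩ X = (A ∩ X) \ S.sym2 ∪ (B ∩ S.sym2 ∩ X) := by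
    ext e
    simp only [Finset.mem_inter, mem_swap, Finset.mem_union, Finset.mem_sdiff]
    tauto
  have h2 : Disjoint ((A ∩ X) \ S.sym2) (B ∩ S.sym2 ∩ X) := by
    rw [Finset.disjoint_left]
    simp only [Finset.mem_inter, Finset.mem_sdiff]
    tauto
  have h3 := Finset.card_sdiff_add_card_inter (A ∩ X) S.sym2
  have h4 : A ∩ S.sym2 ∩ X = A ∩ X ∩ S.sym2 := Finset.inter_right_comm _ _ _
  rw [h1, Finset.card_union_of_disjoint h2, h4]
  omega

theorem card_swap (A B : Finset (Sym2 V)) (S : Finset V) :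
    (swap A B S).card + (A ∩ S.sym2).card = A.card + (B ∩ S.sym2).card := by
  have h := card_swap_inter A B (A ∪ B) S
  have h1 : swap A B S ⊆ A ∪ B := by
    intro e he
    rw [mem_swap] at he
    rw [Finset.mem_union]
    tauto
  rwa [Finset.inter_eq_left.2 h1,
    Finset.inter_eq_left.2 (Finset.inter_subset_left.trans Finset.subset_union_left),
    Finset.inter_eq_left.2 (Finset.inter_subset_left.trans Finset.subset_union_right),
    Finset.inter_eq_left.2 Finset.subset_union_left] at h

/-! ### Alternating lists and alternating paths -/

theorem Alt.mem_union {A B : Finset (Sym2 V)} {l : List (Sym2 V)} (h : Alt A B l) :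
    ∀ e ∈ l, e ∈ A ∧ e ∉ B ∨ e ∈ B ∧ e ∉ A := by
  induction l generalizing A B with
  | nil => simp
  | cons f l ih =>
    intro e he
    rcases List.mem_cons.1 he with rfl | he
    · exact Or.inl ⟨h.1, h.2.1⟩
    · exact (ih h.2.2 e he).symm

/-- Restoring `e` can only spoil a condition "not in `A`" at `e` itself, and such a condition is
imposed on edges of `B` only. The two statements need each other because the roles alternate along
the list. -/
theorem Alt.of_erase {A B : Finset (Sym2 V)} {l : List (Sym2 V)} {e : Sym2 V} (he : e ∉ B) :
    (Alt B (A.erase e) l → Alt B A l) ∧ (Alt (A.erase e) B l → Alt A B l) := by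
  induction l with
  | nil => exact ⟨fun _ => trivial, fun _ => trivial⟩
  | cons f l ih =>
    refine ⟨fun h => ⟨h.1, fun hf => h.2.1 (Finset.mem_erase.2 ⟨?_, hf⟩), ih.2 h.2.2⟩,
      fun h => ⟨Finset.mem_of_mem_erase h.1, h.2.1, ih.1 h.2.2⟩⟩
    rintro rfl
    exact he h.1

theorem Alt.card_inter {A B : Finset (Sym2 V)} {l : List (Sym2 V)} (h : Alt A B l)
    (hl : l.Nodup) :
    (A ∩ l.toFinset).card = (B ∩ l.toFinset).card + l.length % 2 := by
  induction l generalizing A B with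
  | nil => simp
  | cons e l ih =>
    have h1 := ih h.2.2 (List.nodup_cons.1 hl).2
    have h2 : e ∉ l.toFinset := by simpa using (List.nodup_cons.1 hl).1
    rw [List.toFinset_cons, Finset.inter_insert_of_mem h.1, Finset.inter_insert_of_notMem h.2.1,
      Finset.card_insert_of_notMem (fun h3 => h2 (Finset.mem_inter.1 h3).2), List.length_cons]
    omega

theorem Alt.getElem? {A B : Finset (Sym2 V)} {l : List (Sym2 V)} (h : Alt A B l) {i : ℕ}
    {e : Sym2 V} (hi : l[i]? = some e) :
    (Even i → e ∈ A ∧ e ∉ B) ∧ (¬ Even i → e ∈ B ∧ e ∉ A) := by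
  induction l generalizing A B i with
  | nil => simp at hi
  | cons f l ih =>
    rcases i with _ | i
    · simp only [List.getElem?_cons_zero, Option.some.injEq] at hi
      subst hi
      exact ⟨fun _ => ⟨h.1, h.2.1⟩, fun h => absurd Even.zero h⟩
    · simp only [List.getElem?_cons_succ] at hi
      rw [Nat.even_add_one, not_not]
      exact (ih h.2.2 hi).symm

/-- A path that alternates between two matchings, starting at a vertex not covered by the second,
starts with the first. -/
theorem alt_edges {A B : Finset (Sym2 V)} (hA : IsMatching G A) (hB : IsMatching G B) {x y : V}
    (p : G.Walk x y) (hp : p.IsPath) (h : ∀ e ∈ p.edges, e ∈ A ∨ e ∈ B) (hx : x ∉ cover B) :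
    Alt A B p.edges := by
  induction p generalizing A B with
  | nil => trivial
  | @cons x x' y hadj p ih =>
    rw [SimpleGraph.Walk.edges_cons] at h ⊢
    have heB : s(x, x') ∉ B := fun he => hx (mem_cover.2 ⟨_, he, by simp⟩)
    have heA : s(x, x') ∈ A := (h _ (by simp)).resolve_right heB
    have hp' := (SimpleGraph.Walk.cons_isPath_iff hadj p).1 hp
    refine ⟨heA, heB, (Alt.of_erase (e := s(x, x')) heB).1 ?_⟩
    · refine ih hB (hA.subset (Finset.erase_subset _ _)) hp'.1 (fun e he => ?_) ?_
      · rcases h e (by simp [he]) with h | h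
        · refine Or.inr (Finset.mem_erase.2 ⟨?_, h⟩)
          rintro rfl
          exact hp'.2 (p.fst_mem_support_of_mem_edges he)
        · exact Or.inl h
      · rw [mem_cover]
        rintro ⟨e, he, hx'⟩
        rw [Finset.mem_erase] at he
        exact he.1 (hA.eq_of_mem he.2 heA hx' (by simp))

/-- Follow the `A`-edge at `x`, erase it, and continue from its other end with the roles of the
matchings exchanged; the number of remaining edges drops. The closure clause says that the path is a
whole component of `A ∪ B`. -/
theorem exists_alternating_path {A B : Finset (Sym2 V)} (hA : IsMatching G A)
    (hB : IsMatching G B) {x : V} (hx : x ∉ cover B) :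
    ∃ (y : V) (p : G.Walk x y), p.IsPath ∧ Alt A B p.edges ∧
      (∀ z ∈ p.support, ∀ e ∈ A ∪ B, z ∈ e → e ∈ p.edges) ∧
      (Even p.length → y ∉ cover A) ∧ (Odd p.length → y ∉ cover B) := by
  induction hn : A.card + B.card using Nat.strong_induction_on generalizing A B x with
  | _ n ih =>
  by_cases hxA : x ∈ cover A
  · obtain ⟨e, he, hxe⟩ := mem_cover.1 hxA
    obtain ⟨x', rfl⟩ := Sym2.mem_iff_exists.1 hxe
    have hadj : G.Adj x x' := hA.1 _ he
    have heB : s(x, x') ∉ B := fun he => hx (mem_cover.2 ⟨_, he, hxe⟩)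
    have hx' : x' ∉ cover (A.erase s(x, x')) := by
      rw [mem_cover]
      rintro ⟨f, hf, hxf⟩
      rw [Finset.mem_erase] at hf
      exact hf.1 (hA.eq_of_mem hf.2 he hxf (by simp))
    have hlt : B.card + (A.erase s(x, x')).card < n := by
      have := Finset.card_erase_lt_of_mem he
      omega
    obtain ⟨y, p, hp, halt, hcl, hev, hod⟩ :=
      ih _ hlt hB (hA.subset (Finset.erase_subset _ _)) hx' rfl
    have halt' : Alt B A p.edges := (Alt.of_erase heB).1 halt
    -- The path cannot return to `x`: no `B`-edge is there, and the only `A`-edge has been erased.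
    have hxp : x ∉ p.support := by
      intro hxp
      have hne : ¬ p.Nil := by
        intro hnil
        rw [SimpleGraph.Walk.nil_iff_support_eq.1 hnil] at hxp
        exact hadj.ne (by simpa using hxp)
      obtain ⟨f, hf, hxf⟩ := (SimpleGraph.Walk.mem_support_iff_exists_mem_edges_of_not_nil hne).1 hxp
      rcases halt.mem_union f hf with h | h
      · exact hx (mem_cover.2 ⟨f, h.1, hxf⟩)
      · rw [Finset.mem_erase] at h
        exact h.1.1 (hA.eq_of_mem h.1.2 he hxf hxe)
    have hyx : y ≠ x := fun h => hxp (h ▸ p.end_mem_support)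
    refine ⟨y, .cons hadj p, (SimpleGraph.Walk.cons_isPath_iff hadj p).2 ⟨hp, hxp⟩,
      ⟨he, heB, halt'⟩, ?_, ?_, ?_⟩
    · intro z hz f hf hzf
      rw [SimpleGraph.Walk.edges_cons, List.mem_cons]
      by_cases hfe : f = s(x, x')
      · exact Or.inl hfe
      rw [Finset.mem_union] at hf
      rw [SimpleGraph.Walk.support_cons, List.mem_cons] at hz
      rcases hz with rfl | hz
      · rcases hf with hf | hf
        · exact Or.inl (hA.eq_of_mem hf he hzf hxe)
        · exact absurd (mem_cover.2 ⟨f, hf, hzf⟩) hx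
      · refine Or.inr (hcl z hz f ?_ hzf)
        rw [Finset.mem_union, Finset.mem_erase]
        tauto
    · intro h
      rw [SimpleGraph.Walk.length_cons, Nat.even_add_one, Nat.not_even_iff_odd] at h
      intro hy
      obtain ⟨f, hf, hyf⟩ := mem_cover.1 hy
      by_cases hfe : f = s(x, x')
      · subst hfe
        rcases Sym2.mem_iff.1 hyf with rfl | rfl
        · exact hyx rfl
        · rw [SimpleGraph.Walk.isPath_iff_nil, ← SimpleGraph.Walk.length_eq_zero_iff] at hp
          simp [hp] at h
      · exact hod h (mem_cover.2 ⟨f, Finset.mem_erase.2 ⟨hfe, hf⟩, hyf⟩)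
    · intro h
      rw [SimpleGraph.Walk.length_cons, Nat.odd_add_one, Nat.not_odd_iff_even] at h
      exact hev h
  · refine ⟨x, .nil, .nil, trivial, ?_, fun _ => hxA, fun h => by simp at h⟩
    intro z hz e he hze
    rw [SimpleGraph.Walk.support_nil, List.mem_singleton] at hz
    subst hz
    rcases Finset.mem_union.1 he with he | he
    · exact absurd (mem_cover.2 ⟨e, he, hze⟩) hxA
    · exact absurd (mem_cover.2 ⟨e, he, hze⟩) hx

/-- Connects exchanges on vertex sets with counts along edge lists: inside the support, `A` and `B`
have no edges except those of the path. -/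
theorem closed_support {A B : Finset (Sym2 V)} {x y : V} {p : G.Walk x y}
    (hcl : ∀ z ∈ p.support, ∀ e ∈ A ∪ B, z ∈ e → e ∈ p.edges) :
    IsClosedUnder p.support.toFinset A ∧ IsClosedUnder p.support.toFinset B ∧
      A ∩ p.support.toFinset.sym2 = A ∩ p.edges.toFinset ∧
      B ∩ p.support.toFinset.sym2 = B ∩ p.edges.toFinset := by
  have hsub : ∀ e ∈ p.edges, ∀ z ∈ e, z ∈ p.support :=
    fun e he z hz => SimpleGraph.Walk.mem_support_of_mem_edges he hz
  have key : ∀ C ⊆ A ∪ B, IsClosedUnder p.support.toFinset C ∧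
      C ∩ p.support.toFinset.sym2 = C ∩ p.edges.toFinset := by
    intro C hC
    refine ⟨fun e he z hz w hw hzS => ?_, ?_⟩
    · rw [List.mem_toFinset] at hzS ⊢
      exact hsub e (hcl z hzS e (hC he) hz) w hw
    · ext e
      rw [Finset.mem_inter, Finset.mem_inter, List.mem_toFinset, Finset.mem_sym2_iff]
      refine and_congr_right fun he => ⟨fun h => ?_, fun h z hz => ?_⟩
      · exact hcl _ (List.mem_toFinset.1 (h _ (Sym2.out_fst_mem e))) e (hC he)
          (Sym2.out_fst_mem e)
      · exact List.mem_toFinset.2 (hsub e h z hz)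
  exact ⟨(key A Finset.subset_union_left).1, (key B Finset.subset_union_right).1,
    (key A Finset.subset_union_left).2, (key B Finset.subset_union_right).2⟩

end Matchings

section Extremal

variable {V : Type*} [Fintype V] [DecidableEq V] {G : SimpleGraph V}

/-! ### Extremal properties of maximally intersecting triples -/

theorem IsMatching.card_le_nu {M : Finset (Sym2 V)} (hM : IsMatching G M) : M.card ≤ nu G :=
  le_csSup ⟨Fintype.card (Sym2 V), by rintro _ ⟨M, -, rfl⟩; exact Finset.card_le_univ M⟩
    ⟨M, hM, rfl⟩

theorem IsDisjointPair.card_le_lam {H H' : Finset (Sym2 V)} (h : IsDisjointPair G H H') :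
    H.card + H'.card ≤ lam G :=
  le_csSup ⟨Fintype.card (Sym2 V) + Fintype.card (Sym2 V), by
    rintro _ ⟨H, H', -, rfl⟩
    exact add_le_add (Finset.card_le_univ H) (Finset.card_le_univ H')⟩ ⟨H, H', h, rfl⟩

theorem InLambda.card_le_mu {H H' : Finset (Sym2 V)} (h : InLambda G H H') : H.card ≤ mu G :=
  le_csSup ⟨Fintype.card (Sym2 V), by rintro _ ⟨M, _, -, rfl⟩; exact Finset.card_le_univ M⟩
    ⟨H, H', h, rfl⟩

theorem isMatching_empty : IsMatching G (∅ : Finset (Sym2 V)) := by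
  constructor <;> simp

theorem exists_isAdmissible (G : SimpleGraph V) :
    ∃ M H H' : Finset (Sym2 V), IsAdmissible G M H H' := by
  obtain ⟨M, hM⟩ : nu G ∈ {n | ∃ M, IsMatching G M ∧ M.card = n} :=
    Nat.sSup_mem ⟨0, ∅, isMatching_empty, rfl⟩
      ⟨Fintype.card (Sym2 V), by rintro _ ⟨M, -, rfl⟩; exact Finset.card_le_univ M⟩
  obtain ⟨K, K', hK⟩ : lam G ∈ {n | ∃ H H', IsDisjointPair G H H' ∧ H.card + H'.card = n} :=
    Nat.sSup_mem ⟨0, ∅, ∅, ⟨isMatching_empty, isMatching_empty, Finset.disjoint_empty_left _⟩, rfl⟩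
      ⟨Fintype.card (Sym2 V) + Fintype.card (Sym2 V), by
        rintro _ ⟨H, H', -, rfl⟩
        exact add_le_add (Finset.card_le_univ H) (Finset.card_le_univ H')⟩
  obtain ⟨H, H', hH⟩ : mu G ∈ {n | ∃ H H', InLambda G H H' ∧ H.card = n} :=
    Nat.sSup_mem ⟨_, K, K', hK, rfl⟩
      ⟨Fintype.card (Sym2 V), by rintro _ ⟨M, _, -, rfl⟩; exact Finset.card_le_univ M⟩
  exact ⟨M, H, H', hM, hH⟩

theorem exists_isMaximallyIntersecting (G : SimpleGraph V) :
    ∃ M H H' : Finset (Sym2 V), IsMaximallyIntersecting G M H H' := by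
  obtain ⟨M₀, H₀, H₀', h₀⟩ := exists_isAdmissible G
  obtain ⟨⟨M₁, H₁, H₁'⟩, h₁, hmax₁⟩ := Set.exists_max_image
    {t : Finset (Sym2 V) × Finset (Sym2 V) × Finset (Sym2 V) | IsAdmissible G t.1 t.2.1 t.2.2}
    (fun t => (t.1 ∩ (t.2.1 ∪ t.2.2)).card) (Set.toFinite _) ⟨(M₀, H₀, H₀'), h₀⟩
  obtain ⟨⟨M, H, H'⟩, h, hmax⟩ := Set.exists_max_image
    {t : Finset (Sym2 V) × Finset (Sym2 V) × Finset (Sym2 V) | IsUnionMaximal G t.1 t.2.1 t.2.2}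
    (fun t => (t.1 ∩ t.2.1).card) (Set.toFinite _)
    ⟨(M₁, H₁, H₁'), h₁, fun N K K' hN => hmax₁ (N, K, K') hN⟩
  exact ⟨M, H, H', h, fun N K K' hN => hmax (N, K, K') hN⟩

variable {M H H' : Finset (Sym2 V)}

/-- Interchanging `H` and `H'` on `S` gives another pair in Λ, whose first member must not exceed
`μ`. -/
theorem InLambdaMu.card_inter_le (h : InLambdaMu G H H') {S : Finset V}
    (hS : IsClosedUnder S H) (hS' : IsClosedUnder S H') :
    (H' ∩ S.sym2).card ≤ (H ∩ S.sym2).card := by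
  obtain ⟨⟨⟨hH, hH', hd⟩, hlam⟩, hmu⟩ := h
  have h1 := card_swap H H' S
  have h2 := card_swap H' H S
  have h3 : InLambda G (swap H H' S) (swap H' H S) := by
    refine ⟨⟨hH.swap hH' hS, hH'.swap hH hS', ?_⟩, by omega⟩
    rw [Finset.disjoint_left] at hd ⊢
    intro e
    have := @hd e
    rw [mem_swap, mem_swap]
    tauto
  have := h3.card_le_mu
  omega

namespace IsMaximallyIntersecting

theorem matching_left (h : IsMaximallyIntersecting G M H H') : IsMatching G M := h.1.1.1.1

theorem matching_mid (h : IsMaximallyIntersecting G M H H') : IsMatching G H := h.1.1.2.1.1.1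

theorem matching_right (h : IsMaximallyIntersecting G M H H') : IsMatching G H' := h.1.1.2.1.1.2.1

theorem disjoint (h : IsMaximallyIntersecting G M H H') : Disjoint H H' := h.1.1.2.1.1.2.2

theorem card_left (h : IsMaximallyIntersecting G M H H') : M.card = nu G := h.1.1.1.2

theorem card_mid (h : IsMaximallyIntersecting G M H H') : H.card = mu G := h.1.1.2.2

/-- If `M` can be exchanged on `S` with a matching `B` inside `H ∪ H'` without becoming smaller,
then `M` lies in `H ∪ H'` on `S`. -/
theorem inter_subset_union (h : IsMaximallyIntersecting G M H H') {B : Finset (Sym2 V)}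
    (hB : IsMatching G B) (hBH : B ⊆ H ∪ H') {S : Finset V} (hS : IsClosedUnder S M)
    (hcard : (M ∩ S.sym2).card ≤ (B ∩ S.sym2).card) : M ∩ S.sym2 ⊆ H ∪ H' := by
  have h1 := card_swap M B S
  have h2 := h.matching_left.swap hB hS
  have h3 := h2.card_le_nu
  have h4 := h.card_left
  have h5 := h.1.2 (swap M B S) H H' ⟨⟨h2, by omega⟩, h.1.1.2⟩
  have h6 := card_swap_inter M B (H ∪ H') S
  rw [Finset.inter_eq_left.2 (Finset.inter_subset_left.trans hBH : B ∩ S.sym2 ⊆ H ∪ H')] at h6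
  refine Finset.inter_eq_left.1 (Finset.eq_of_subset_of_card_le Finset.inter_subset_left ?_)
  omega

/-- Replacing `M` by `H` on `S` does not decrease the first intersection, so the new triple still
competes for the second. Maximality of `|M ∩ H|` then leaves no edge of `M` inside `S` outside `H`.
-/
theorem inter_eq_of_card_le (h : IsMaximallyIntersecting G M H H') {S : Finset V}
    (hS : IsClosedUnder S M)
    (hcard : (M ∩ S.sym2).card ≤ (H ∩ S.sym2).card) : M ∩ S.sym2 = H ∩ S.sym2 := by
  have h1 := card_swap M H S
  have h2 := h.matching_left.swap h.matching_mid hS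
  have h3 := h2.card_le_nu
  have h4 := h.card_left
  have h5 : IsAdmissible G (swap M H S) H H' := ⟨⟨h2, by omega⟩, h.1.1.2⟩
  have h6 := card_swap_inter M H (H ∪ H') S
  have h7 := card_swap_inter M H H S
  have h8 : H ∩ S.sym2 ∩ (H ∪ H') = H ∩ S.sym2 :=
    Finset.inter_eq_left.2 (Finset.inter_subset_left.trans Finset.subset_union_left)
  have h9 : H ∩ S.sym2 ∩ H = H ∩ S.sym2 := Finset.inter_eq_left.2 Finset.inter_subset_left
  rw [h8] at h6
  rw [h9] at h7
  have h10 : (M ∩ S.sym2 ∩ (H ∪ H')).card ≤ (M ∩ S.sym2).card :=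
    Finset.card_le_card Finset.inter_subset_left
  have h11 : IsUnionMaximal G (swap M H S) H H' :=
    ⟨h5, fun N K K' hN => (h.1.2 N K K' hN).trans (by omega)⟩
  have h12 := h.2 _ _ _ h11
  have h13 : M ∩ S.sym2 ∩ H = M ∩ S.sym2 :=
    Finset.eq_of_subset_of_card_le Finset.inter_subset_left (by omega)
  refine Finset.eq_of_subset_of_card_le (fun e he => ?_) (by omega)
  exact Finset.mem_inter.2 ⟨Finset.inter_eq_left.1 h13 he, (Finset.mem_inter.1 he).2⟩

/-- From a vertex missed by `M`, the maximal alternating path starts with `H` and has at least as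
many `H`-edges as `M`-edges. The exchange lemma makes `M` and `H` agree on it, so the `H`-edge at
the start would be in `M`. -/
theorem cover_mid_subset (h : IsMaximallyIntersecting G M H H') : cover H ⊆ cover M := by
  intro x hx
  by_contra hxM
  obtain ⟨y, p, hp, halt, hcl, -, -⟩ :=
    exists_alternating_path h.matching_mid h.matching_left hxM
  obtain ⟨hSH, hSM, hH, hM⟩ := closed_support hcl
  have h1 := halt.card_inter hp.isTrail.edges_nodup
  rw [← hH, ← hM] at h1
  have h2 := h.inter_eq_of_card_le hSM (by omega)
  obtain ⟨e, he, hxe⟩ := mem_cover.1 hx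
  have h3 : e ∈ M ∩ p.support.toFinset.sym2 := by
    rw [h2]
    exact Finset.mem_inter.2 ⟨he, hSH.mem_sym2 he hxe (by simp)⟩
  exact hxM (mem_cover.2 ⟨e, (Finset.mem_inter.1 h3).1, hxe⟩)

/-- An edge of `M` outside `H ∪ H'` cannot be exchanged for at most one edge of `H` or `H'`. -/
theorem exchange_false {K K₁ : Finset (Sym2 V)} {e : Sym2 V} {y : V}
    (h : IsMaximallyIntersecting G M H H') (heM : e ∈ M) (he : e ∉ H ∪ H')
    (hK : K = H ∧ K₁ = H' ∨ K = H' ∧ K₁ = H) {x : V} (hxy : e = s(x, y)) (hx : x ∉ cover K) :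
    False := by
  have hKm : IsMatching G K := by
    rcases hK with ⟨rfl, -⟩ | ⟨rfl, -⟩
    exacts [h.matching_mid, h.matching_right]
  have hU : K ∪ K₁ = H ∪ H' := by
    rcases hK with ⟨rfl, rfl⟩ | ⟨rfl, rfl⟩
    exacts [rfl, Finset.union_comm _ _]
  have hd : Disjoint K K₁ := by
    rcases hK with ⟨rfl, rfl⟩ | ⟨rfl, rfl⟩
    exacts [h.disjoint, h.disjoint.symm]
  rw [← hU, Finset.mem_union, not_or] at he
  set D := K.filter (fun f => y ∉ f) with hD
  have hDK : D ⊆ K := Finset.filter_subset _ _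
  have hsplit : D.card + (K.filter (fun f => y ∈ f)).card = K.card := by
    rw [hD, add_comm]
    exact Finset.card_filter_add_card_filter_not _
  have hle : (K.filter (fun f => y ∈ f)).card ≤ 1 := by
    rw [Finset.card_le_one]
    intro a ha b hb
    rw [Finset.mem_filter] at ha hb
    exact hKm.eq_of_mem ha.1 hb.1 ha.2 hb.2
  have hcard : (insert e D).card = D.card + 1 :=
    Finset.card_insert_of_notMem fun h' => he.1 (hDK h')
  have hmatch : IsMatching G (insert e D) := by
    have key : ∀ f ∈ D, ∀ z, z ∈ e → z ∈ f → False := by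
      intro f hf z hze hzf
      rw [hxy] at hze
      rcases Sym2.mem_iff.1 hze with rfl | rfl
      · exact hx (mem_cover.2 ⟨f, hDK hf, hzf⟩)
      · exact (Finset.mem_filter.1 hf).2 hzf
    refine ⟨fun f hf => ?_, fun f hf g hg z hz hz' => ?_⟩
    · rcases Finset.mem_insert.1 hf with rfl | hf
      exacts [h.matching_left.1 _ heM, hKm.1 _ (hDK hf)]
    · rcases Finset.mem_insert.1 hf with rfl | hfD <;> rcases Finset.mem_insert.1 hg with rfl | hgD
      · rfl
      · exact (key g hgD z hz hz').elim
      · exact (key f hfD z hz' hz).elim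
      · exact hKm.eq_of_mem (hDK hfD) (hDK hgD) hz hz'
  have hdis : Disjoint (insert e D) K₁ :=
    Finset.disjoint_insert_left.2 ⟨he.2, hd.mono_left hDK⟩
  have hlam : (insert e D).card + K₁.card ≤ lam G ∧ K.card + K₁.card = lam G := by
    have h1 := h.1.1.2.1.2
    have h2 := h.1.1.2.1.1
    rcases hK with ⟨rfl, rfl⟩ | ⟨rfl, rfl⟩
    · exact ⟨IsDisjointPair.card_le_lam ⟨hmatch, h2.2.1, hdis⟩, h1⟩
    · exact ⟨IsDisjointPair.card_le_lam ⟨hmatch, h2.1, hdis⟩, by omega⟩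
  have hcardK : (insert e D).card = K.card := by omega
  have hub : (M ∩ (insert e D ∪ K₁)).card ≤ (M ∩ (K ∪ K₁)).card := by
    obtain ⟨⟨h2, h3⟩, h4⟩ := h.1.1.2
    have h5 := h.1.1.1
    rcases hK with ⟨rfl, rfl⟩ | ⟨rfl, rfl⟩
    · exact h.1.2 M (insert e D) K₁ ⟨h5, ⟨⟨hmatch, h2.2.1, hdis⟩, by omega⟩, by omega⟩
    · rw [Finset.union_comm, Finset.union_comm K]
      exact h.1.2 M K₁ (insert e D) ⟨h5, ⟨⟨h2.1, hmatch, hdis.symm⟩, by omega⟩, by omega⟩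
  -- Nothing of the intersection is lost: a removed edge contains `y`, and the only `M`-edge at `y`
  -- is `e`. So the intersection gains `e`.
  have hss : insert e (M ∩ (K ∪ K₁)) ⊆ M ∩ (insert e D ∪ K₁) := by
    intro f hf
    rcases Finset.mem_insert.1 hf with rfl | hf
    · simp [heM]
    · rw [Finset.mem_inter, Finset.mem_union] at hf ⊢
      refine ⟨hf.1, hf.2.imp_left fun hfK => Finset.mem_insert.2 ?_⟩
      by_cases hyf : y ∈ f
      · exact Or.inl (h.matching_left.eq_of_mem hf.1 heM hyf (by simp [hxy]))
      · exact Or.inr (Finset.mem_filter.2 ⟨hfK, hyf⟩)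
  have h1 := Finset.card_le_card hss
  rw [Finset.card_insert_of_notMem] at h1
  · omega
  · simp [he]

theorem mem_cover_of_notMem (h : IsMaximallyIntersecting G M H H') {e : Sym2 V} (heM : e ∈ M)
    (he : e ∉ H ∪ H') {x : V} (hx : x ∈ e) : x ∈ cover H ∧ x ∈ cover H' := by
  obtain ⟨y, hxy⟩ := Sym2.mem_iff_exists.1 hx
  constructor <;> by_contra hc
  · exact h.exchange_false heM he (Or.inl ⟨rfl, rfl⟩) hxy hc
  · exact h.exchange_false heM he (Or.inr ⟨rfl, rfl⟩) hxy hc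

theorem mem_right_of_notMem_cover (h : IsMaximallyIntersecting G M H H') {e : Sym2 V}
    (heM : e ∈ M) {x : V} (hx : x ∈ e) (hxH : x ∉ cover H) : e ∈ H' := by
  by_contra he
  refine hxH (h.mem_cover_of_notMem heM ?_ hx).1
  rw [Finset.mem_union]
  rintro (h1 | h1)
  exacts [hxH (mem_cover.2 ⟨e, h1, hx⟩), he h1]

end IsMaximallyIntersecting
end Extremal

section PathSystem

variable {V : Type*} {G : SimpleGraph V}

/-! ### Subgraphs that are unions of alternating odd paths -/

theorem mem_of_reachable {W : Type*} {F : SimpleGraph W} {S : Set W}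
    (hS : ∀ x ∈ S, ∀ y, F.Adj x y → y ∈ S) {x y : W} (h : F.Reachable x y) (hx : x ∈ S) :
    y ∈ S := by
  obtain ⟨p⟩ := h
  induction p with
  | nil => exact hx
  | cons hadj p ih => exact ih (hS _ hx _ hadj)

theorem IsPathComponent.reverse {K : G.Subgraph} {u v : V} {p : G.Walk u v}
    (h : IsPathComponent K p) : IsPathComponent K p.reverse := by
  refine ⟨h.1.reverse, ?_, fun x hx y hxy => ?_⟩
  · rw [SimpleGraph.Walk.toSubgraph_reverse]
    exact h.2.1
  · rw [SimpleGraph.Walk.support_reverse, List.mem_reverse] at hx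
    rw [SimpleGraph.Walk.edges_reverse, List.mem_reverse]
    exact h.2.2 x hx y hxy

theorem start_edge_unique {u v : V} {p : G.Walk u v} (hp : p.IsPath) {e f : Sym2 V}
    (he : e ∈ p.edges) (hf : f ∈ p.edges) (hue : u ∈ e) (huf : u ∈ f) : e = f := by
  cases p with
  | nil => simp at he
  | @cons _ w _ hadj q =>
    have hu := ((SimpleGraph.Walk.cons_isPath_iff hadj q).1 hp).2
    have key : ∀ g ∈ (SimpleGraph.Walk.cons hadj q).edges, u ∈ g → g = s(u, w) := by
      intro g hg hug
      rcases List.mem_cons.1 hg with rfl | hg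
      · rfl
      · exact absurd (SimpleGraph.Walk.mem_support_of_mem_edges hg hug) hu
    rw [key e he hue, key f hf huf]

theorem toSubgraph_le_of_edges {K : G.Subgraph} {u v : V} {p : G.Walk u v} (hu : u ∈ K.verts)
    (h : ∀ e ∈ p.edges, e ∈ K.edgeSet) : p.toSubgraph ≤ K := by
  by_cases hnil : p.Nil
  · cases p with
    | nil => simpa using hu
    | cons => simp at hnil
  · exact (SimpleGraph.Walk.toSubgraph_le_iff hnil).2 h

variable [DecidableEq V]

/-- `K` has the edges `A ∪ B` for disjoint matchings `A` and `B`, the first of which covers `K`,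
while the second covers no component of `K`. -/
structure IsPathSystem (K : G.Subgraph) (A B : Finset (Sym2 V)) : Prop where
  left : IsMatching G A
  right : IsMatching G B
  disjoint : Disjoint A B
  adj : ∀ x y, K.Adj x y ↔ s(x, y) ∈ A ∪ B
  verts : ∀ x, x ∈ K.verts ↔ x ∈ cover A
  not_covered : ∀ S : Finset V, S.Nonempty → (∀ x ∈ S, x ∈ K.verts) → IsClosedUnder S A →
    IsClosedUnder S B → ¬ S ⊆ cover B

theorem isPathComponent_of_alt {K : G.Subgraph} {A B : Finset (Sym2 V)}
    (hadj : ∀ x y, K.Adj x y ↔ s(x, y) ∈ A ∪ B) {x y : V} {p : G.Walk x y} (hp : p.IsPath)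
    (hx : x ∈ K.verts) (halt : Alt A B p.edges)
    (hcl : ∀ z ∈ p.support, ∀ e ∈ A ∪ B, z ∈ e → e ∈ p.edges) : IsPathComponent K p := by
  refine ⟨hp, toSubgraph_le_of_edges hx fun e he => ?_,
    fun z hz w hzw => hcl z hz _ ((hadj z w).1 hzw) (by simp)⟩
  induction e with
  | _ a b =>
  rw [SimpleGraph.Subgraph.mem_edgeSet, hadj, Finset.mem_union]
  have := halt.mem_union _ he
  tauto

namespace IsPathSystem

variable {K : G.Subgraph} {A B : Finset (Sym2 V)}

theorem mem_edgeSet (h : IsPathSystem K A B) (e : Sym2 V) : e ∈ K.edgeSet ↔ e ∈ A ∪ B := by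
  induction e with
  | _ a b => rw [SimpleGraph.Subgraph.mem_edgeSet, h.adj]

theorem exists_path_of_notMem_cover (h : IsPathSystem K A B) {u : V} (hu : u ∈ K.verts)
    (huB : u ∉ cover B) :
    ∃ (v : V) (p : G.Walk u v), IsPathComponent K p ∧ Odd p.length ∧ v ∉ cover B ∧
      Alt A B p.edges ∧ ∀ z ∈ p.support, ∀ e ∈ A ∪ B, z ∈ e → e ∈ p.edges := by
  obtain ⟨v, p, hp, halt, hcl, hev, hod⟩ := exists_alternating_path h.left h.right huB
  have hcomp := isPathComponent_of_alt h.adj hp hu halt hcl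
  have hv : v ∈ cover A :=
    (h.verts v).1 (hcomp.2.1.1 (SimpleGraph.Walk.end_mem_verts_toSubgraph p))
  have hodd : Odd p.length := Nat.not_even_iff_odd.1 fun he => hev he hv
  exact ⟨v, p, hcomp, hodd, hod hodd, halt, hcl⟩

/-- By `not_covered`, the component of `x` contains a vertex missed by `B`. The maximal path from
that vertex is closed under adjacency, so it contains `x`. -/
theorem exists_path [Finite V] (h : IsPathSystem K A B) {x : V} (hx : x ∈ K.verts) :
    ∃ (u v : V) (p : G.Walk u v), x ∈ p.support ∧ IsPathComponent K p ∧ Odd p.length ∧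
      u ∉ cover B ∧ v ∉ cover B ∧
      Alt A B p.edges ∧ ∀ z ∈ p.support, ∀ e ∈ A ∪ B, z ∈ e → e ∈ p.edges := by
  classical
  have := Fintype.ofFinite V
  set S : Finset V := Finset.univ.filter fun y => K.spanningCoe.Reachable x y with hS
  have hmem : ∀ y, y ∈ S ↔ K.spanningCoe.Reachable x y := fun y => by simp [hS]
  have hcl : IsClosedUnder S (A ∪ B) := by
    intro e he y hy z hz hyS
    rw [hmem] at hyS ⊢
    rcases eq_or_ne y z with rfl | hne
    · exact hyS
    · have : s(y, z) ∈ A ∪ B := by rwa [← (Sym2.mem_and_mem_iff hne).1 ⟨hy, hz⟩]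
      exact hyS.trans (SimpleGraph.Adj.reachable ((h.adj y z).2 this))
  have hSK : ∀ y ∈ S, y ∈ K.verts := fun y hy =>
    mem_of_reachable (S := K.verts) (fun a _ b hab => K.edge_vert (SimpleGraph.Subgraph.Adj.symm hab))
      ((hmem y).1 hy) hx
  obtain ⟨u, huS, huB⟩ := Finset.not_subset.1 (h.not_covered S ⟨x, by simp [hmem]⟩ hSK
    (hcl.mono Finset.subset_union_left) (hcl.mono Finset.subset_union_right))
  obtain ⟨v, p, hcomp, hodd, hv, halt, hclp⟩ := h.exists_path_of_notMem_cover (hSK u huS) huB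
  refine ⟨u, v, p, ?_, hcomp, hodd, huB, hv, halt, hclp⟩
  refine mem_of_reachable (S := {z | z ∈ p.support}) (fun a ha b hab => ?_)
    ((hmem u).1 huS).symm p.start_mem_support
  exact SimpleGraph.Walk.snd_mem_support_of_mem_edges p (hcomp.2.2 a ha b hab)

/-- An end-vertex lies on at most one edge of its path, and `A` already supplies it. This holds for
any path component, so the odd edges do not depend on a chosen path. -/
theorem start_notMem_cover (h : IsPathSystem K A B) {u v : V} {p : G.Walk u v}
    (hp : IsPathComponent K p) : u ∉ cover B := by
  intro huB
  have hu := (h.verts u).1 (hp.2.1.1 (SimpleGraph.Walk.start_mem_verts_toSubgraph p))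
  have key : ∀ e ∈ A ∪ B, u ∈ e → e ∈ p.edges := by
    intro e he hue
    obtain ⟨y, rfl⟩ := Sym2.mem_iff_exists.1 hue
    exact hp.2.2 u p.start_mem_support y ((h.adj u y).2 he)
  obtain ⟨a, ha, hua⟩ := mem_cover.1 hu
  obtain ⟨b, hb, hub⟩ := mem_cover.1 huB
  have hab := start_edge_unique hp.1 (key a (Finset.mem_union_left _ ha) hua)
    (key b (Finset.mem_union_right _ hb) hub) hua hub
  exact Finset.disjoint_left.1 h.disjoint ha (hab ▸ hb)

theorem alt (h : IsPathSystem K A B) {u v : V} {p : G.Walk u v} (hp : IsPathComponent K p) :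
    Alt A B p.edges := by
  refine alt_edges h.left h.right p hp.1 (fun e he => ?_) (h.start_notMem_cover hp)
  rw [← Finset.mem_union, ← h.mem_edgeSet]
  exact SimpleGraph.Subgraph.edgeSet_mono hp.2.1 ((p.mem_edges_toSubgraph).2 he)

theorem isEndVertex_iff (h : IsPathSystem K A B) {x : V} :
    IsEndVertex K x ↔ x ∈ K.verts ∧ x ∉ cover B := by
  constructor
  · rintro ⟨u, v, p, hp, rfl | rfl⟩
    · exact ⟨hp.2.1.1 (SimpleGraph.Walk.start_mem_verts_toSubgraph p), h.start_notMem_cover hp⟩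
    · exact ⟨hp.2.1.1 (SimpleGraph.Walk.end_mem_verts_toSubgraph p),
        h.start_notMem_cover hp.reverse⟩
  · rintro ⟨hx, hxB⟩
    obtain ⟨v, p, hp, -⟩ := h.exists_path_of_notMem_cover hx hxB
    exact ⟨x, v, p, hp, Or.inl rfl⟩

theorem oddEdges_eq [Finite V] (h : IsPathSystem K A B) : oddEdges K = (A : Set (Sym2 V)) := by
  ext e
  constructor
  · rintro ⟨u, v, p, hp, i, hi, he⟩
    exact (((h.alt hp).getElem? he).1 hi).1
  · intro he
    rw [Finset.mem_coe] at he
    induction e with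
    | _ x y =>
    obtain ⟨u, v, p, hxp, hp, -, -, -, halt, hcl⟩ :=
      h.exists_path ((h.verts x).2 (mem_cover.2 ⟨_, he, by simp⟩))
    obtain ⟨i, hi⟩ := List.mem_iff_getElem?.1
      (hcl x hxp _ (Finset.mem_union_left _ he) (by simp))
    refine ⟨u, v, p, hp, i, ?_, hi⟩
    by_contra hodd
    exact ((halt.getElem? hi).2 hodd).2 he

/-- Count the vertices of `K` missed by `B`: there are `2|A| - 2|B|` of them, and exactly two on
each component. -/
theorem card_connectedComponent [Finite V] (h : IsPathSystem K A B) :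
    Nat.card K.coe.ConnectedComponent = A.card - B.card := by
  classical
  have := Fintype.ofFinite V
  have hBA : cover B ⊆ cover A := by
    intro x hx
    obtain ⟨e, he, hxe⟩ := mem_cover.1 hx
    obtain ⟨y, rfl⟩ := Sym2.mem_iff_exists.1 hxe
    exact (h.verts x).1 (K.edge_vert ((h.adj x y).2 (Finset.mem_union_right _ he)))
  set U : Finset K.verts := Finset.univ.filter fun x => x.1 ∉ cover B with hU
  have hUmap : U.map (Function.Embedding.subtype _) = cover A \ cover B := by
    ext x
    simp [hU, h.verts, and_comm]
  have hUcard : U.card = 2 * A.card - 2 * B.card := by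
    rw [← Finset.card_map, hUmap, Finset.card_sdiff_of_subset hBA, h.left.card_cover,
      h.right.card_cover]
  have hfib : ∀ C : K.coe.ConnectedComponent,
      (U.filter fun x => K.coe.connectedComponentMk x = C).card = 2 := by
    intro C
    induction C using SimpleGraph.ConnectedComponent.ind with
    | _ x =>
    obtain ⟨x, hx⟩ := x
    obtain ⟨u, v, p, hxp, hp, hodd, -, -, halt, hcl⟩ := h.exists_path hx
    obtain ⟨hSA, hSB, hA, hB⟩ := closed_support hcl
    have hcard := halt.card_inter hp.1.isTrail.edges_nodup
    rw [SimpleGraph.Walk.length_edges, Nat.odd_iff.1 hodd, ← hA, ← hB] at hcard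
    have hcA := h.left.two_mul_card_eq hSA
    have hcB := h.right.two_mul_card_eq hSB
    have hSsub : p.support.toFinset ⊆ cover A := by
      intro z hz
      rw [List.mem_toFinset] at hz
      exact (h.verts z).1 (hp.2.1.1 ((p.mem_verts_toSubgraph).2 hz))
    have hmap : (U.filter fun z => K.coe.connectedComponentMk z =
        K.coe.connectedComponentMk ⟨x, hx⟩).map (Function.Embedding.subtype _) =
        p.support.toFinset \ cover B := by
      ext z
      simp only [hU, Finset.mem_map, Finset.mem_filter, Finset.mem_univ, true_and,
        Function.Embedding.subtype_apply, Subtype.exists, exists_and_right, exists_eq_right,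
        Finset.mem_sdiff, List.mem_toFinset, SimpleGraph.ConnectedComponent.eq]
      constructor
      · rintro ⟨hz, hzB, hr⟩
        refine ⟨?_, hzB⟩
        exact mem_of_reachable (S := {w : K.verts | w.1 ∈ p.support})
          (fun a ha b hab => SimpleGraph.Walk.snd_mem_support_of_mem_edges p
            (hp.2.2 a ha b hab)) hr.symm hxp
      · rintro ⟨hz, hzB⟩
        refine ⟨hp.2.1.1 ((p.mem_verts_toSubgraph).2 hz), hzB, ?_⟩
        have := (p.toSubgraph_connected).coe.preconnected
          ⟨z, (p.mem_verts_toSubgraph).2 hz⟩ ⟨x, (p.mem_verts_toSubgraph).2 hxp⟩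
        exact this.map (SimpleGraph.Subgraph.inclusion hp.2.1)
    rw [← Finset.card_map, hmap, ← Finset.sdiff_inter_self_right,
      Finset.card_sdiff_of_subset Finset.inter_subset_right, ← hcB]
    rw [Finset.inter_eq_right.2 hSsub] at hcA
    omega
  have hsum := Finset.card_eq_sum_card_fiberwise (s := U) (t := Finset.univ)
    (f := K.coe.connectedComponentMk) (fun _ _ => by simp)
  rw [Finset.sum_congr rfl (fun C _ => hfib C), Finset.sum_const, Finset.card_univ, smul_eq_mul,
    hUcard] at hsum
  rw [Nat.card_eq_fintype_card]
  omega

end IsPathSystem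
end PathSystem

section Coloring

variable {V : Type*} [DecidableEq V] {G : SimpleGraph V}

/-! ### Unions of two matchings are bipartite -/

theorem coloring_eq_iff_even {c : V → Bool} {u v : V} (p : G.Walk u v)
    (h : ∀ x y, s(x, y) ∈ p.edges → c x ≠ c y) : c u = c v ↔ Even p.length := by
  induction p with
  | nil => simp
  | @cons u w v hadj p ih =>
    have h1 := h u w (by simp)
    have h2 := ih fun x y hxy => h x y (by simp [hxy])
    rw [SimpleGraph.Walk.length_cons, Nat.even_add_one, ← h2]
    revert h1
    cases c u <;> cases c v <;> cases c w <;> simp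

/-- Remove an edge `xy` of `A` and color the rest. If `x` and `y` get the same color, flip the
colors on the component of `x`, a path that avoids `y`. -/
theorem exists_coloring {A B : Finset (Sym2 V)} (hA : IsMatching G A) (hB : IsMatching G B) :
    ∃ c : V → Bool, ∀ x y, s(x, y) ∈ A ∪ B → c x ≠ c y := by
  induction hn : A.card + B.card using Nat.strong_induction_on generalizing A B with
  | _ n ih =>
  wlog hne : A.Nonempty generalizing A B
  · rcases B.eq_empty_or_nonempty with rfl | hB'
    · rw [Finset.not_nonempty_iff_eq_empty] at hne
      subst hne
      exact ⟨fun _ => true, by simp⟩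
    · rw [Finset.union_comm]
      exact this hB hA (by omega) hB'
  obtain ⟨e, he⟩ := hne
  have hA' : IsMatching G (A.erase e) := hA.subset (Finset.erase_subset _ _)
  have hlt := Finset.card_erase_lt_of_mem he
  obtain ⟨c, hc⟩ := ih _ (by omega) hA' hB rfl
  induction e with
  | _ x y =>
  have hcov : ∀ z ∈ s(x, y), z ∉ cover (A.erase s(x, y)) := by
    intro z hz hzc
    obtain ⟨f, hf, hzf⟩ := mem_cover.1 hzc
    rw [Finset.mem_erase] at hf
    exact hf.1 (hA.eq_of_mem hf.2 he hzf hz)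
  have hxy : x ≠ y := (show G.Adj x y from hA.1 _ he).ne
  by_cases hcxy : c x = c y
  · obtain ⟨w, p, hp, halt, hcl, -, -⟩ := exists_alternating_path hB hA' (hcov x (by simp))
    obtain ⟨hSB, hSA, -, -⟩ := closed_support hcl
    have hy : y ∉ p.support := by
      intro hy
      set q := p.takeUntil y hy with hq
      have hqp : ∀ f ∈ q.edges, f ∈ B ∨ f ∈ A.erase s(x, y) := by
        intro f hf
        have := halt.mem_union f (p.edges_takeUntil_subset_edges hy hf)
        tauto
      have hqpath : q.IsPath := hp.takeUntil hy
      have heven : Even q.length := (coloring_eq_iff_even q fun a b hab => hc a b (by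
        rw [Finset.mem_union]
        exact (hqp _ hab).symm)).1 hcxy
      have h1 := alt_edges hB hA' q hqpath hqp (hcov x (by simp))
      have h2 := alt_edges hB hA' q.reverse hqpath.reverse (fun f hf => hqp f (by
        simpa using hf)) (hcov y (by simp))
      rw [SimpleGraph.Walk.edges_reverse] at h2
      have hpos : 0 < q.edges.length := by
        rw [SimpleGraph.Walk.length_edges, Nat.pos_iff_ne_zero]
        exact fun h0 => hxy (SimpleGraph.Walk.eq_of_length_eq_zero h0)
      -- Equal colors make `q` even, so counting from `x` its last edge is in `A`; but read from
      -- `y`, which the remaining `A` also misses, that edge is in `B`.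
      have hlast : q.edges[q.edges.length - 1]? = some (q.edges[q.edges.length - 1]) :=
        List.getElem?_eq_getElem (by omega)
      have hfirst : q.edges.reverse[0]? = some (q.edges[q.edges.length - 1]) := by
        rw [List.getElem?_reverse hpos, ← hlast]
        simp
      have hodd : ¬ Even (q.edges.length - 1) := by
        rw [SimpleGraph.Walk.length_edges] at hpos ⊢
        rw [Nat.even_sub (by omega)]
        simp [heven]
      exact ((h2.getElem? hfirst).1 Even.zero).2 ((h1.getElem? hlast).2 hodd).1
    refine ⟨fun z => if z ∈ p.support then !(c z) else c z, fun a b hab => ?_⟩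
    have hxs := p.start_mem_support
    by_cases hfe : s(a, b) = s(x, y)
    · rcases Sym2.eq_iff.1 hfe with ⟨rfl, rfl⟩ | ⟨rfl, rfl⟩ <;> simp [hxs, hy, hcxy]
    · have hab' : s(a, b) ∈ A.erase s(x, y) ∪ B := by
        rw [Finset.mem_union, Finset.mem_erase] at *
        tauto
      have h1 := hc a b hab'
      have h2 : a ∈ p.support ↔ b ∈ p.support := by
        have key : IsClosedUnder p.support.toFinset (A.erase s(x, y) ∪ B) := by
          intro f hf
          rcases Finset.mem_union.1 hf with hf | hf
          exacts [hSA f hf, hSB f hf]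
        have k1 := key _ hab' a (by simp) b (by simp)
        have k2 := key _ hab' b (by simp) a (by simp)
        simp only [List.mem_toFinset] at k1 k2
        exact ⟨k1, k2⟩
      by_cases hb : b ∈ p.support
      · simp [h2.2 hb, hb, h1]
      · simp [mt h2.1 hb, hb, h1]
  · refine ⟨c, fun a b hab => ?_⟩
    by_cases hfe : s(a, b) = s(x, y)
    · rcases Sym2.eq_iff.1 hfe with ⟨rfl, rfl⟩ | ⟨rfl, rfl⟩
      exacts [hcxy, Ne.symm hcxy]
    · refine hc a b ?_
      rw [Finset.mem_union, Finset.mem_erase] at *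
      tauto

end Coloring

section Covered

variable {V : Type*} [Fintype V] [DecidableEq V] {G : SimpleGraph V} {M H H' : Finset (Sym2 V)}

/-! ### The subgraph formed by the alternating paths -/

/-- A single edge of the symmetric difference is already a nontrivial alternating path. -/
theorem alternatingUnion_adj (hM : IsMatching G M) (hH : IsMatching G H) (x y : V) :
    (alternatingUnion G (M : Set (Sym2 V)) H).Adj x y ↔ s(x, y) ∈ M \ H ∪ H \ M := by
  rw [alternatingUnion, SimpleGraph.Subgraph.sSup_adj]
  constructor
  · rintro ⟨_, ⟨u, v, p, hp, -, rfl⟩, hxy⟩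
    rw [SimpleGraph.Walk.adj_toSubgraph_iff_mem_edges] at hxy
    simpa using hp.2.1 _ hxy
  · intro hxy
    have hadj : G.Adj x y := by
      rw [Finset.mem_union, Finset.mem_sdiff, Finset.mem_sdiff] at hxy
      rcases hxy with hxy | hxy
      exacts [hM.1 _ hxy.1, hH.1 _ hxy.1]
    refine ⟨_, ⟨x, y, .cons hadj .nil, ⟨by simp [hadj.ne], ?_, ?_⟩, by simp, rfl⟩, by simp⟩
    · simpa using hxy
    · simp

theorem mem_verts_alternatingUnion (hM : IsMatching G M) (hH : IsMatching G H) (x : V) :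
    x ∈ (alternatingUnion G (M : Set (Sym2 V)) H).verts ↔ x ∈ cover (M \ H ∪ H \ M) := by
  constructor
  · intro hx
    rw [alternatingUnion, SimpleGraph.Subgraph.verts_sSup, Set.mem_iUnion₂] at hx
    obtain ⟨_, ⟨u, v, p, hp, hpos, rfl⟩, hx⟩ := hx
    rw [SimpleGraph.Walk.mem_verts_toSubgraph,
      SimpleGraph.Walk.mem_support_iff_exists_mem_edges_of_not_nil
        (fun hnil => hpos.ne' (SimpleGraph.Walk.length_eq_zero_iff.2 hnil))] at hx
    obtain ⟨e, he, hxe⟩ := hx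
    exact mem_cover.2 ⟨e, by simpa using hp.2.1 _ he, hxe⟩
  · intro hx
    obtain ⟨e, he, hxe⟩ := mem_cover.1 hx
    obtain ⟨y, rfl⟩ := Sym2.mem_iff_exists.1 hxe
    exact SimpleGraph.Subgraph.edge_vert _ ((alternatingUnion_adj hM hH x y).2 he)

/-- Closure under `A \ B` inside the vertices covered by `A \ B` is closure under `A`. -/
theorem IsClosedUnder.of_sdiff {A B : Finset (Sym2 V)} (hA : IsMatching G A) {S : Finset V}
    (h : IsClosedUnder S (A \ B)) (hS : S ⊆ cover (A \ B)) : IsClosedUnder S A := by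
  intro e he x hx y hy hxS
  obtain ⟨f, hf, hxf⟩ := mem_cover.1 (hS hxS)
  have hef := hA.eq_of_mem he (Finset.mem_sdiff.1 hf).1 hx hxf
  subst hef
  exact h e hf x hx y hy hxS

/-- Likewise for `B`, provided `A ∩ B` does not touch the set. -/
theorem IsClosedUnder.of_sdiff_right {A B : Finset (Sym2 V)} (hA : IsMatching G A) {S : Finset V}
    (h : IsClosedUnder S (B \ A)) (hS : S ⊆ cover (A \ B)) : IsClosedUnder S B := by
  intro e he x hx y hy hxS
  by_cases heA : e ∈ A
  · obtain ⟨f, hf, hxf⟩ := mem_cover.1 (hS hxS)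
    have hef := hA.eq_of_mem heA (Finset.mem_sdiff.1 hf).1 hx hxf
    subst hef
    exact absurd he (Finset.mem_sdiff.1 hf).2
  · exact h e (Finset.mem_sdiff.2 ⟨he, heA⟩) x hx y hy hxS

theorem notMem_cover_of_sdiff {A B : Finset (Sym2 V)} (hA : IsMatching G A) {x : V}
    (hx : x ∈ cover (A \ B)) (hx' : x ∉ cover (B \ A)) : x ∉ cover B := by
  intro hxB
  obtain ⟨f, hf, hxf⟩ := mem_cover.1 hx
  obtain ⟨e, he, hxe⟩ := mem_cover.1 hxB
  by_cases heA : e ∈ A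
  · have hef := hA.eq_of_mem heA (Finset.mem_sdiff.1 hf).1 hxe hxf
    subst hef
    exact absurd he (Finset.mem_sdiff.1 hf).2
  · exact hx' (mem_cover.2 ⟨e, Finset.mem_sdiff.2 ⟨he, heA⟩, hxe⟩)

/-- A component covered by `H` has at least as many `H`-edges as `M`-edges, so the exchange lemma
makes the two agree there, although it contains an edge of `M \ H`. This excludes cycles and even
paths; covering `E` is not needed. -/
theorem IsMaximallyIntersecting.isPathSystem (h : IsMaximallyIntersecting G M H H') :
    IsPathSystem (alternatingUnion G (M : Set (Sym2 V)) H) (M \ H) (H \ M) := by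
  have hverts : ∀ x, x ∈ (alternatingUnion G (M : Set (Sym2 V)) H).verts ↔ x ∈ cover (M \ H) := by
    intro x
    rw [mem_verts_alternatingUnion h.matching_left h.matching_mid]
    refine ⟨fun hx => ?_, fun hx => cover_mono Finset.subset_union_left hx⟩
    obtain ⟨e, he, hxe⟩ := mem_cover.1 hx
    rw [Finset.mem_union] at he
    rcases he with he | he
    · exact mem_cover.2 ⟨e, he, hxe⟩
    · rw [Finset.mem_sdiff] at he
      obtain ⟨f, hf, hxf⟩ := mem_cover.1 (h.cover_mid_subset (mem_cover.2 ⟨e, he.1, hxe⟩))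
      refine mem_cover.2 ⟨f, Finset.mem_sdiff.2 ⟨hf, fun hfH => ?_⟩, hxf⟩
      exact he.2 (h.matching_mid.eq_of_mem he.1 hfH hxe hxf ▸ hf)
  refine ⟨h.matching_left.subset Finset.sdiff_subset, h.matching_mid.subset Finset.sdiff_subset,
    disjoint_sdiff_sdiff, alternatingUnion_adj h.matching_left h.matching_mid, hverts, ?_⟩
  intro S ⟨x, hx⟩ hSK hSA hSB hcov
  have hSA' : S ⊆ cover (M \ H) := fun z hz => (hverts z).1 (hSK z hz)
  have hSM := hSA.of_sdiff h.matching_left hSA'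
  have hSH := hSB.of_sdiff_right h.matching_left hSA'
  have h1 := h.matching_mid.two_mul_card_eq hSH
  rw [Finset.inter_eq_right.2 (hcov.trans (cover_mono Finset.sdiff_subset))] at h1
  have h2 := h.matching_left.two_mul_card_le S
  have h3 := h.inter_eq_of_card_le hSM (by omega)
  obtain ⟨e, he, hxe⟩ := mem_cover.1 (hSA' hx)
  rw [Finset.mem_sdiff] at he
  have h4 : e ∈ H ∩ S.sym2 := by
    rw [← h3]
    exact Finset.mem_inter.2 ⟨he.1, hSM.mem_sym2 he.1 hxe hx⟩
  exact he.2 (Finset.mem_inter.1 h4).1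

theorem IsPathSystem.edges_closed {K : G.Subgraph} {A B : Finset (Sym2 V)}
    (h : IsPathSystem K A B) {u v : V} {p : G.Walk u v} (hp : IsPathComponent K p) :
    ∀ z ∈ p.support, ∀ e ∈ A ∪ B, z ∈ e → e ∈ p.edges := by
  intro z hz e he hze
  obtain ⟨y, rfl⟩ := Sym2.mem_iff_exists.1 hze
  exact hp.2.2 z hz y ((h.adj z y).2 he)

/-- Every `M`, `H` alternating path has an `M`-edge outside `H'`. -/
theorem IsMaximallyIntersecting.exists_edge_notMem (h : IsMaximallyIntersecting G M H H')
    {u v : V} {p : G.Walk u v}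
    (hp : IsPathComponent (alternatingUnion G (M : Set (Sym2 V)) H) p) :
    ∃ e ∈ p.edges, e ∈ M ∧ e ∉ H ∪ H' := by
  by_contra! hno
  have hK := h.isPathSystem
  have hcl := hK.edges_closed hp
  obtain ⟨hSA, hSB, -, -⟩ := closed_support hcl
  have hSA' : p.support.toFinset ⊆ cover (M \ H) := fun z hz =>
    (hK.verts z).1 (hp.2.1.1 ((p.mem_verts_toSubgraph).2 (List.mem_toFinset.1 hz)))
  have hSH := hSB.of_sdiff_right h.matching_left hSA'
  have key : ∀ z ∈ p.support, ∃ e ∈ M \ H, z ∈ e ∧ e ∈ H' := by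
    intro z hz
    obtain ⟨e, he, hze⟩ := mem_cover.1 (hSA' (List.mem_toFinset.2 hz))
    have h1 := hno e (hcl z hz e (Finset.mem_union_left _ he) hze) (Finset.mem_sdiff.1 he).1
    exact ⟨e, he, hze, (Finset.mem_union.1 h1).resolve_left (Finset.mem_sdiff.1 he).2⟩
  have hSH' : IsClosedUnder p.support.toFinset H' := by
    intro e he x hx y hy hxS
    obtain ⟨f, hf, hxf, hfH'⟩ := key x (List.mem_toFinset.1 hxS)
    have hef := h.matching_right.eq_of_mem he hfH' hx hxf
    subst hef
    exact hSA e hf x hx y hy hxS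
  have hcov : p.support.toFinset ⊆ cover H' := by
    intro z hz
    obtain ⟨f, -, hzf, hfH'⟩ := key z (List.mem_toFinset.1 hz)
    exact mem_cover.2 ⟨f, hfH', hzf⟩
  -- `H'` covers the whole support while `H` misses `u`, so `H'` is larger there.
  have h1 := h.1.1.2.card_inter_le hSH hSH'
  have h2 := h.matching_right.two_mul_card_eq hSH'
  have h3 := h.matching_mid.two_mul_card_eq hSH
  rw [Finset.inter_eq_right.2 hcov] at h2
  have hu : u ∉ cover H := notMem_cover_of_sdiff h.matching_left (hSA' (by simp))
    (hK.start_notMem_cover hp)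
  have h4 : (cover H ∩ p.support.toFinset).card < p.support.toFinset.card := by
    refine Finset.card_lt_card (Finset.ssubset_iff_subset_ne.2 ⟨Finset.inter_subset_right, ?_⟩)
    intro heq
    exact hu (Finset.inter_eq_right.1 heq (by simp))
  omega

theorem start_mem_edge {u v : V} {p : G.Walk u v} {e : Sym2 V} (h : p.edges[0]? = some e) :
    u ∈ e := by
  cases p with
  | nil => simp at h
  | cons hadj q =>
    simp only [SimpleGraph.Walk.edges_cons, List.getElem?_cons_zero, Option.some.injEq] at h
    simp [← h]

/-- The edge outside `H ∪ H'` has its ends covered by `H`, while the ends of the path are not. It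
therefore has an even index that is neither the first nor the last. -/
theorem IsMaximallyIntersecting.five_le_length (h : IsMaximallyIntersecting G M H H')
    {u v : V} {p : G.Walk u v}
    (hp : IsPathComponent (alternatingUnion G (M : Set (Sym2 V)) H) p) (hodd : Odd p.length) :
    5 ≤ p.length := by
  have hK := h.isPathSystem
  obtain ⟨e, hep, heM, he⟩ := h.exists_edge_notMem hp
  have hend : ∀ {a b : V} {q : G.Walk a b},
      IsPathComponent (alternatingUnion G (M : Set (Sym2 V)) H) q → a ∉ e := by
    intro a b q hq hae
    refine notMem_cover_of_sdiff h.matching_left ?_ (hK.start_notMem_cover hq)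
      (h.mem_cover_of_notMem heM he hae).1
    exact (hK.verts a).1 (hq.2.1.1 (SimpleGraph.Walk.start_mem_verts_toSubgraph q))
  obtain ⟨i, hi⟩ := List.mem_iff_getElem?.1 hep
  have hilt : i < p.edges.length := (List.getElem?_eq_some_iff.1 hi).1
  have heven : Even i := by
    by_contra hne
    exact (Finset.mem_sdiff.1 (((hK.alt hp).getElem? hi).2 hne).1).2 heM
  have hi0 : i ≠ 0 := by
    rintro rfl
    exact hend hp (start_mem_edge hi)
  have hilast : i ≠ p.edges.length - 1 := by
    intro hlast
    refine hend hp.reverse (start_mem_edge (p := p.reverse) ?_)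
    rw [SimpleGraph.Walk.edges_reverse, List.getElem?_reverse (by omega), ← hi, hlast]
    simp
  rw [SimpleGraph.Walk.length_edges] at hilt hilast
  rw [Nat.even_iff] at heven
  rw [Nat.odd_iff] at hodd
  omega

/-! ### Connected graphs covered by a maximally intersecting triple -/

/-- Connectedness enters the structural arguments only here. -/
theorem eq_univ_of_closed (hconn : G.Connected) (hc : Covers G M H H') {S : Finset V}
    (hne : S.Nonempty) (hM : IsClosedUnder S M) (hH : IsClosedUnder S H)
    (hH' : IsClosedUnder S H') : S = Finset.univ := by
  obtain ⟨x, hx⟩ := hne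
  refine Finset.eq_univ_of_forall fun y => ?_
  refine mem_of_reachable (S := (S : Set V)) (fun a ha b hab => ?_) (hconn.preconnected x y) hx
  have he : s(a, b) ∈ (M : Set (Sym2 V)) ∪ H ∪ H' := hc ▸ hab
  rcases he with (he | he) | he
  · exact hM _ he a (by simp) b (by simp) ha
  · exact hH _ he a (by simp) b (by simp) ha
  · exact hH' _ he a (by simp) b (by simp) ha

namespace IsMaximallyIntersecting

theorem not_subset (h : IsMaximallyIntersecting G M H H') (hlt : mu G < nu G) : ¬ M ⊆ H := by
  intro hMH
  have := Finset.card_le_card hMH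
  rw [h.card_left, h.card_mid] at this
  omega

theorem cover_mid_ne_univ (h : IsMaximallyIntersecting G M H H') (hlt : mu G < nu G) :
    cover H ≠ Finset.univ := by
  intro hu
  have h1 := h.matching_mid.card_cover
  have h2 := h.matching_left.card_cover
  have h3 := Finset.card_le_univ (cover M)
  rw [hu, Finset.card_univ] at h1
  rw [h.card_mid] at h1
  rw [h.card_left] at h2
  omega

/-- Exchange `M` with `H'` on the alternating path from a vertex missed by `M`: there `M` must lie
in `H ∪ H'`, and in fact in `H`. Then none of the three matchings leaves the path, so it spans `G`
and `M ⊆ H`. -/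
theorem cover_left_eq_univ (h : IsMaximallyIntersecting G M H H') (hc : Covers G M H H')
    (hconn : G.Connected) (hlt : mu G < nu G) : cover M = Finset.univ := by
  refine Finset.eq_univ_of_forall fun x => ?_
  by_contra hx
  obtain ⟨y, p, hp, halt, hcl, -, -⟩ :=
    exists_alternating_path h.matching_right h.matching_left hx
  obtain ⟨hSH', hSM, hH', hM⟩ := closed_support hcl
  have h1 := halt.card_inter hp.isTrail.edges_nodup
  rw [← hH', ← hM] at h1
  have h2 := h.inter_subset_union h.matching_right Finset.subset_union_right hSM (by omega)
  have key : ∀ e ∈ M, ∀ z ∈ e, z ∈ p.support → e ∈ H := by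
    intro e he z hze hz
    have h3 := h2 (Finset.mem_inter.2 ⟨he, hSM.mem_sym2 he hze (List.mem_toFinset.2 hz)⟩)
    refine (Finset.mem_union.1 h3).resolve_right fun h4 => ?_
    -- An edge of the alternating path lies in only one of `H'` and `M`.
    have := halt.mem_union e (hcl z hz e (Finset.mem_union_left _ h4) hze)
    tauto
  have hSH : IsClosedUnder p.support.toFinset H := by
    intro e he z hz w hw hzS
    obtain ⟨f, hf, hzf⟩ := mem_cover.1 (h.cover_mid_subset (mem_cover.2 ⟨e, he, hz⟩))
    have hfe := h.matching_mid.eq_of_mem he (key f hf z hzf (List.mem_toFinset.1 hzS)) hz hzf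
    subst hfe
    exact hSM e hf z hz w hw hzS
  have huniv := eq_univ_of_closed hconn hc ⟨x, by simp⟩ hSM hSH hSH'
  refine h.not_subset hlt fun e he => ?_
  refine key e he _ (Sym2.out_fst_mem e) ?_
  rw [← List.mem_toFinset, huniv]
  exact Finset.mem_univ _

theorem exists_left (h : IsMaximallyIntersecting G M H H') (hc : Covers G M H H')
    (hconn : G.Connected) (hlt : mu G < nu G) (x : V) : ∃ e ∈ M, x ∈ e :=
  mem_cover.1 (h.cover_left_eq_univ hc hconn hlt ▸ Finset.mem_univ x)

/-- Outside `V'` the `M`-edge at a vertex is also its `H`-edge, so only edges of `M ∩ H` and of `H'`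
remain. A component covered by these `H'`-edges would be closed under all three matchings, hence all
of `G`, and `M ⊆ H`. -/
theorem isPathSystem_complementPart (h : IsMaximallyIntersecting G M H H') (hc : Covers G M H H')
    (hconn : G.Connected) (hlt : mu G < nu G) :
    IsPathSystem (complementPart G (alternatingUnion G (M : Set (Sym2 V)) H)) (M ∩ H)
      (H' ∩ (cover (M \ H))ᶜ.sym2) := by
  have hK := h.isPathSystem
  have hin : ∀ x, x ∉ cover (M \ H) → ∀ e ∈ M, x ∈ e → e ∈ M ∩ H := by
    intro x hx e he hxe
    refine Finset.mem_inter.2 ⟨he, ?_⟩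
    by_contra heH
    exact hx (mem_cover.2 ⟨e, Finset.mem_sdiff.2 ⟨he, heH⟩, hxe⟩)
  have hin' : ∀ x, x ∉ cover (M \ H) → ∀ e ∈ H, x ∈ e → e ∈ M ∩ H := by
    intro x hx e he hxe
    obtain ⟨f, hf, hxf⟩ := h.exists_left hc hconn hlt x
    have hf' := hin x hx f hf hxf
    rwa [h.matching_mid.eq_of_mem he (Finset.mem_inter.1 hf').2 hxe hxf]
  have hout : ∀ e ∈ M ∩ H, ∀ x ∈ e, x ∉ cover (M \ H) := by
    intro e he x hxe hx
    obtain ⟨f, hf, hxf⟩ := mem_cover.1 hx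
    rw [Finset.mem_sdiff] at hf
    rw [Finset.mem_inter] at he
    exact hf.2 (h.matching_left.eq_of_mem he.1 hf.1 hxe hxf ▸ he.2)
  have hverts : ∀ x, x ∈ (complementPart G (alternatingUnion G (M : Set (Sym2 V)) H)).verts ↔
      x ∉ cover (M \ H) := by
    intro x
    simp [complementPart, hK.verts]
  refine ⟨h.matching_left.subset Finset.inter_subset_left,
    h.matching_right.subset Finset.inter_subset_left,
    h.disjoint.mono Finset.inter_subset_right Finset.inter_subset_left, ?_, ?_, ?_⟩
  · intro x y
    rw [complementPart, SimpleGraph.Subgraph.deleteVerts_adj, hK.verts, hK.verts]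
    simp only [SimpleGraph.Subgraph.verts_top, Set.mem_univ, true_and,
      SimpleGraph.Subgraph.top_adj, Finset.mem_union]
    constructor
    · rintro ⟨hx, hy, hxy⟩
      have he : s(x, y) ∈ (M : Set (Sym2 V)) ∪ H ∪ H' := hc ▸ hxy
      rcases he with (he | he) | he
      · exact Or.inl (hin x hx _ he (by simp))
      · exact Or.inl (hin' x hx _ he (by simp))
      · refine Or.inr (Finset.mem_inter.2 ⟨he, ?_⟩)
        simp [hx, hy]
    · rintro (he | he)
      · exact ⟨hout _ he x (by simp), hout _ he y (by simp),
          h.matching_left.1 _ (Finset.mem_inter.1 he).1⟩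
      · rw [Finset.mem_inter, Finset.mk_mem_sym2_iff, Finset.mem_compl, Finset.mem_compl] at he
        exact ⟨he.2.1, he.2.2, h.matching_right.1 _ he.1⟩
  · intro x
    rw [hverts]
    constructor
    · intro hx
      obtain ⟨e, he, hxe⟩ := h.exists_left hc hconn hlt x
      exact mem_cover.2 ⟨e, hin x hx e he hxe, hxe⟩
    · intro hx
      obtain ⟨e, he, hxe⟩ := mem_cover.1 hx
      exact hout e he x hxe
  · intro S hne hSK hSA hSB hcov
    have hSM : IsClosedUnder S M := fun e he x hx y hy hxS =>
      hSA e (hin x ((hverts x).1 (hSK x hxS)) e he hx) x hx y hy hxS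
    have hSH : IsClosedUnder S H := fun e he x hx y hy hxS =>
      hSA e (hin' x ((hverts x).1 (hSK x hxS)) e he hx) x hx y hy hxS
    have hSH' : IsClosedUnder S H' := by
      intro e he x hx y hy hxS
      obtain ⟨f, hf, hxf⟩ := mem_cover.1 (hcov hxS)
      have hef := h.matching_right.eq_of_mem he (Finset.mem_inter.1 hf).1 hx hxf
      subst hef
      exact hSB e hf x hx y hy hxS
    have huniv := eq_univ_of_closed hconn hc hne hSM hSH hSH'
    refine h.not_subset hlt fun e he => ?_
    have h1 := (hverts _).1 (hSK (Quot.out e).1 (huniv ▸ Finset.mem_univ _))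
    exact (Finset.mem_inter.1 (hin _ h1 e he (Sym2.out_fst_mem e))).2

end IsMaximallyIntersecting
end Covered

section Degrees

variable {V : Type*} [DecidableEq V] {G : SimpleGraph V}

/-! ### Vertex degrees -/

/-- The edges of `A` at the vertex `x`. -/
def star (A : Finset (Sym2 V)) (x : V) : Finset (Sym2 V) := A.filter (x ∈ ·)

theorem star_eq_singleton {A : Finset (Sym2 V)} (hA : IsMatching G A) {e : Sym2 V} {x : V}
    (he : e ∈ A) (hx : x ∈ e) : star A x = {e} := by
  ext f
  rw [star, Finset.mem_filter, Finset.mem_singleton]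
  refine ⟨fun hf => hA.eq_of_mem hf.1 he hf.2 hx, ?_⟩
  rintro rfl
  exact ⟨he, hx⟩

theorem star_eq_empty {A : Finset (Sym2 V)} {x : V} (hx : x ∉ cover A) : star A x = ∅ :=
  Finset.filter_eq_empty_iff.2 fun e he hxe => hx (mem_cover.2 ⟨e, he, hxe⟩)

theorem card_star_le {A : Finset (Sym2 V)} (hA : IsMatching G A) (x : V) :
    (star A x).card ≤ 1 := by
  by_cases hx : x ∈ cover A
  · obtain ⟨e, he, hxe⟩ := mem_cover.1 hx
    simp [star_eq_singleton hA he hxe]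
  · simp [star_eq_empty hx]

variable [Fintype V] [DecidableRel G.Adj] {M H H' : Finset (Sym2 V)}

theorem Covers.degree_eq (hc : Covers G M H H') (x : V) :
    G.degree x = (star M x ∪ star H x ∪ star H' x).card := by
  rw [← SimpleGraph.card_incidenceFinset_eq_degree]
  congr 1
  ext e
  have he : e ∈ G.edgeSet ↔ e ∈ (M : Set (Sym2 V)) ∪ H ∪ H' := by rw [← hc]
  simp only [Set.mem_union, Finset.mem_coe] at he
  rw [SimpleGraph.incidenceFinset_eq_filter]
  simp only [Finset.mem_filter, SimpleGraph.mem_edgeFinset, he, star, Finset.mem_union]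
  tauto

namespace IsMaximallyIntersecting

theorem degree_le_three (h : IsMaximallyIntersecting G M H H') (hc : Covers G M H H') (x : V) :
    G.degree x ≤ 3 := by
  rw [hc.degree_eq]
  have h1 := Finset.card_union_le (star M x ∪ star H x) (star H' x)
  have h2 := Finset.card_union_le (star M x) (star H x)
  have h3 := card_star_le h.matching_left x
  have h4 := card_star_le h.matching_mid x
  have h5 := card_star_le h.matching_right x
  omega

theorem degree_le_two (h : IsMaximallyIntersecting G M H H') (hc : Covers G M H H') {e : Sym2 V}
    (heM : e ∈ M) (he : e ∈ H ∪ H') {x : V} (hx : x ∈ e) : G.degree x ≤ 2 := by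
  rw [hc.degree_eq]
  have h1 := Finset.card_union_le (star H x) (star H' x)
  have h4 := card_star_le h.matching_mid x
  have h5 := card_star_le h.matching_right x
  have h6 : star M x ∪ star H x ∪ star H' x = star H x ∪ star H' x := by
    rw [Finset.union_assoc, Finset.union_eq_right, star_eq_singleton h.matching_left heM hx,
      Finset.singleton_subset_iff]
    rw [Finset.mem_union] at he ⊢
    exact he.imp (fun he => Finset.mem_filter.2 ⟨he, hx⟩) (fun he => Finset.mem_filter.2 ⟨he, hx⟩)
  rw [h6]
  omega

theorem degree_eq_three (h : IsMaximallyIntersecting G M H H') (hc : Covers G M H H')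
    {e : Sym2 V} (heM : e ∈ M) (he : e ∉ H ∪ H') {x : V} (hx : x ∈ e) : G.degree x = 3 := by
  obtain ⟨h1, h2⟩ := h.mem_cover_of_notMem heM he hx
  obtain ⟨f, hf, hxf⟩ := mem_cover.1 h1
  obtain ⟨g, hg, hxg⟩ := mem_cover.1 h2
  rw [Finset.mem_union, not_or] at he
  rw [hc.degree_eq, star_eq_singleton h.matching_left heM hx,
    star_eq_singleton h.matching_mid hf hxf, star_eq_singleton h.matching_right hg hxg]
  have hef : e ≠ f := by rintro rfl; exact he.1 hf
  have heg : e ≠ g := by rintro rfl; exact he.2 hg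
  have hfg : f ≠ g := by rintro rfl; exact Finset.disjoint_left.1 h.disjoint hf hg
  rw [Finset.union_assoc]
  exact Finset.card_eq_three.2 ⟨e, f, g, hef, heg, hfg, rfl⟩

theorem degree_eq_one (h : IsMaximallyIntersecting G M H H') (hc : Covers G M H H')
    {x : V} (hx : x ∈ cover M) (hxH : x ∉ cover H) : G.degree x = 1 := by
  obtain ⟨e, he, hxe⟩ := mem_cover.1 hx
  rw [hc.degree_eq, star_eq_singleton h.matching_left he hxe, star_eq_empty hxH,
    star_eq_singleton h.matching_right (h.mem_right_of_notMem_cover he hxe hxH) hxe]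
  simp

theorem richEdges_eq (h : IsMaximallyIntersecting G M H H') (hc : Covers G M H H') :
    richEdges G (alternatingUnion G (M : Set (Sym2 V)) H) = {e | e ∈ M ∧ e ∉ H ∪ H'} := by
  ext e
  rw [richEdges, Set.mem_ofPred_eq, Set.mem_ofPred_eq, h.isPathSystem.oddEdges_eq, Finset.mem_coe,
    Finset.mem_sdiff]
  constructor
  · rintro ⟨⟨heM, -⟩, hdeg⟩
    refine ⟨heM, fun he => ?_⟩
    have h1 := h.degree_le_two hc heM he (Sym2.out_fst_mem e)
    have h2 := hdeg _ (Sym2.out_fst_mem e)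
    omega
  · rintro ⟨heM, he⟩
    exact ⟨⟨heM, fun heH => he (Finset.mem_union_left _ heH)⟩,
      fun x hx => h.degree_eq_three hc heM he hx⟩

/-- `H'` is written first because alternating paths from a vertex missed by `H` begin with `H'`. -/
theorem poorPart_adj (h : IsMaximallyIntersecting G M H H') (hc : Covers G M H H') (x y : V) :
    (poorPart G (alternatingUnion G (M : Set (Sym2 V)) H)).Adj x y ↔ s(x, y) ∈ H' ∪ H := by
  rw [poorPart, SimpleGraph.Subgraph.deleteEdges_adj, h.richEdges_eq hc,
    SimpleGraph.Subgraph.top_adj, ← SimpleGraph.mem_edgeSet, hc]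
  simp only [Set.mem_union, Finset.mem_coe, Set.mem_ofPred_eq, Finset.mem_union]
  tauto

/-! ### The alternating paths form a skeleton -/

/-- On an odd path beginning with `H'`, interchanging `H` and `H'` would enlarge `H`. -/
theorem end_vertex_even (h : IsMaximallyIntersecting G M H H') (hc : Covers G M H H') {x : V}
    (hx : x ∉ cover H) : ∃ (a b : V) (q : G.Walk a b),
      IsPathComponent (poorPart G (alternatingUnion G (M : Set (Sym2 V)) H)) q ∧
      x ∈ q.support ∧ Even q.length := by
  obtain ⟨y, p, hp, halt, hcl, -, -⟩ :=
    exists_alternating_path h.matching_right h.matching_mid hx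
  refine ⟨x, y, p, isPathComponent_of_alt (h.poorPart_adj hc) hp (by simp [poorPart]) halt hcl,
    by simp, ?_⟩
  obtain ⟨hSH', hSH, hH', hH⟩ := closed_support hcl
  have h1 := halt.card_inter hp.isTrail.edges_nodup
  have h2 := h.1.1.2.card_inter_le hSH hSH'
  rw [hH, hH', h1, SimpleGraph.Walk.length_edges] at h2
  rw [Nat.even_iff]
  omega

/-- An even path has an odd number of vertices, so `H`, which does not leave it, misses one; that
vertex lies on an edge of `M \ H` and is an end of a path. -/
theorem even_path_end (h : IsMaximallyIntersecting G M H H') (hc : Covers G M H H')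
    (hconn : G.Connected) (hlt : mu G < nu G) {a b : V} {q : G.Walk a b}
    (hq : IsPathComponent (poorPart G (alternatingUnion G (M : Set (Sym2 V)) H)) q)
    (heven : Even q.length) :
    ∃ x ∈ q.support, IsEndVertex (alternatingUnion G (M : Set (Sym2 V)) H) x := by
  have hSH : IsClosedUnder q.support.toFinset H := by
    intro e he x hx y hy hxS
    rw [List.mem_toFinset] at hxS ⊢
    rcases eq_or_ne x y with rfl | hne
    · exact hxS
    · rw [(Sym2.mem_and_mem_iff hne).1 ⟨hx, hy⟩] at he
      exact SimpleGraph.Walk.snd_mem_support_of_mem_edges q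
        (hq.2.2 x hxS y ((h.poorPart_adj hc x y).2 (Finset.mem_union_right _ he)))
  have hnsub : ¬ q.support.toFinset ⊆ cover H := by
    intro hsub
    have h1 := h.matching_mid.two_mul_card_eq hSH
    rw [Finset.inter_eq_right.2 hsub, List.toFinset_card_of_nodup hq.1.support_nodup,
      SimpleGraph.Walk.length_support] at h1
    rw [Nat.even_iff] at heven
    omega
  obtain ⟨x, hx, hxH⟩ := Finset.not_subset.1 hnsub
  refine ⟨x, List.mem_toFinset.1 hx, h.isPathSystem.isEndVertex_iff.2 ⟨?_, ?_⟩⟩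
  · obtain ⟨e, he, hxe⟩ := h.exists_left hc hconn hlt x
    refine (h.isPathSystem.verts x).2 (mem_cover.2 ⟨e, Finset.mem_sdiff.2 ⟨he, ?_⟩, hxe⟩)
    exact fun heH => hxH (mem_cover.2 ⟨e, heH, hxe⟩)
  · exact fun h' => hxH (cover_mono Finset.sdiff_subset h')

theorem poorPart_isBipartite (h : IsMaximallyIntersecting G M H H') (hc : Covers G M H H') :
    (poorPart G (alternatingUnion G (M : Set (Sym2 V)) H)).spanningCoe.IsBipartite := by
  obtain ⟨c, hcol⟩ := exists_coloring h.matching_right h.matching_mid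
  have := (SimpleGraph.Coloring.mk (G := (poorPart G
    (alternatingUnion G (M : Set (Sym2 V)) H)).spanningCoe) c
    fun {x y} hxy => hcol x y ((h.poorPart_adj hc x y).1 hxy)).colorable
  simpa using this

theorem skeletonMatching_eq (h : IsMaximallyIntersecting G M H H') (hc : Covers G M H H')
    (hconn : G.Connected) (hlt : mu G < nu G) :
    skeletonMatching G (alternatingUnion G (M : Set (Sym2 V)) H) = M := by
  rw [skeletonMatching, h.isPathSystem.oddEdges_eq,
    (h.isPathSystem_complementPart hc hconn hlt).oddEdges_eq, ← Finset.coe_union,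
    Finset.sdiff_union_inter]

end IsMaximallyIntersecting

/-! ### Alternating cycles -/

theorem alt_or_alt {A B : Finset (Sym2 V)} (hd : Disjoint A B) {l : List (Sym2 V)}
    (hl : ∀ e ∈ l, e ∈ A ∨ e ∈ B) (hch : l.IsChain (fun e f => e ∈ A ↔ f ∈ B)) :
    Alt A B l ∨ Alt B A l := by
  have hdA : ∀ e ∈ A, e ∉ B := fun e he => Finset.disjoint_left.1 hd he
  have hdB : ∀ e ∈ B, e ∉ A := fun e he => Finset.disjoint_right.1 hd he
  induction l with
  | nil => exact Or.inl trivial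
  | cons e l ih =>
    have h1 := ih (fun f hf => hl f (List.mem_cons_of_mem _ hf)) hch.tail
    cases l with
    | nil =>
      rcases hl e (by simp) with he | he
      exacts [Or.inl ⟨he, hdA e he, trivial⟩, Or.inr ⟨he, hdB e he, trivial⟩]
    | cons f l =>
      rw [List.isChain_cons_cons] at hch
      rcases h1 with h1 | h1
      · have heA : e ∉ A := fun he => h1.2.1 (hch.1.1 he)
        have heB := (hl e (by simp)).resolve_left heA
        exact Or.inr ⟨heB, heA, h1⟩
      · have heA : e ∈ A := hch.1.2 h1.1
        exact Or.inl ⟨heA, hdA e heA, h1⟩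

/-- On a cycle, two edges at a vertex other than a third one coincide. -/
theorem cycle_edge_unique {a : V} {c : G.Walk a a} (hc : c.IsCycle) {z : V} {e f m : Sym2 V}
    (he : e ∈ c.edges) (hf : f ∈ c.edges) (hm : m ∈ c.edges) (hze : z ∈ e) (hzf : z ∈ f)
    (hzm : z ∈ m) (hem : e ≠ m) (hfm : f ≠ m) : e = f := by
  have h2 := hc.ncard_neighborSet_toSubgraph_eq_two
    (SimpleGraph.Walk.mem_support_of_mem_edges hm hzm)
  obtain ⟨x, rfl⟩ := Sym2.mem_iff_exists.1 hze
  obtain ⟨y, rfl⟩ := Sym2.mem_iff_exists.1 hzf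
  obtain ⟨w, rfl⟩ := Sym2.mem_iff_exists.1 hzm
  obtain ⟨s, t, -, hst⟩ := Set.ncard_eq_two.1 h2
  have key : ∀ v, s(z, v) ∈ c.edges → v = s ∨ v = t := by
    intro v hv
    have : v ∈ c.toSubgraph.neighborSet z := SimpleGraph.Walk.adj_toSubgraph_iff_mem_edges.2 hv
    rwa [hst] at this
  have hxw : x ≠ w := by rintro rfl; exact hem rfl
  have hyw : y ≠ w := by rintro rfl; exact hfm rfl
  have h3 := key x he
  have h4 := key y hf
  have h5 := key w hm
  have : x = y := by
    rcases h3 with rfl | rfl <;> rcases h4 with rfl | rfl <;> rcases h5 with rfl | rfl <;>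
      first | rfl | exact absurd rfl hxw | exact absurd rfl hyw
  rw [this]

namespace IsMaximallyIntersecting

/-- Exchanging `M` along the cycle with the other cycle edges shows that all cycle edges lie in `H ∪
H'`. Each vertex then has its `H`-edge and its `H'`-edge on the cycle, so the cycle spans `G` and
`H` is perfect, contradicting `μ < ν`. -/
theorem not_isAlternatingCycle (h : IsMaximallyIntersecting G M H H') (hc : Covers G M H H')
    (hconn : G.Connected) (hlt : mu G < nu G) {a : V} (c : G.Walk a a) :
    ¬ IsAlternatingCycle (M : Set (Sym2 V)) (G.edgeSet \ M) c := by
  rintro ⟨hcyc, ⟨-, hch⟩, heven⟩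
  set F := c.edges.toFinset with hF
  set B := F \ M with hB
  set S := c.support.toFinset with hS
  have hFS : ∀ e ∈ F, ∀ z ∈ e, z ∈ S := fun e he z hz => List.mem_toFinset.2
    (SimpleGraph.Walk.mem_support_of_mem_edges (List.mem_toFinset.1 he) hz)
  have hFG : ∀ e ∈ F, e ∈ G.edgeSet := fun e he =>
    c.edges_subset_edgeSet (List.mem_toFinset.1 he)
  have hdMB : Disjoint M B := Finset.disjoint_sdiff
  have halt : Alt M B c.edges ∨ Alt B M c.edges := by
    refine alt_or_alt hdMB (fun e he => ?_) (hch.imp_of_mem_imp ?_)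
    · by_cases heM : e ∈ M
      exacts [Or.inl heM, Or.inr (Finset.mem_sdiff.2 ⟨List.mem_toFinset.2 he, heM⟩)]
    · intro e f he hf hef
      have hfF : f ∈ F := List.mem_toFinset.2 hf
      rw [hB, Finset.mem_sdiff, ← Finset.mem_coe, hef, Set.mem_sdiff, Finset.mem_coe]
      simp [hfF, hFG f hfF]
  have hnd := hcyc.isTrail.edges_nodup
  have hBF : B ∩ F = B := Finset.inter_eq_left.2 Finset.sdiff_subset
  have hMB : (M ∩ F).card = B.card := by
    have hlen : c.edges.length % 2 = 0 := by
      rw [SimpleGraph.Walk.length_edges]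
      exact Nat.even_iff.1 heven
    rcases halt with halt | halt
    · have := halt.card_inter hnd
      rw [hlen, ← hF, hBF] at this
      omega
    · have := halt.card_inter hnd
      rw [hlen, ← hF, hBF] at this
      omega
  have hScard : S.card = F.card := by
    have h1 : S = c.support.tail.toFinset := by
      ext z
      rw [hS, List.mem_toFinset, List.mem_toFinset, SimpleGraph.Walk.mem_support_iff]
      refine ⟨?_, Or.inr⟩
      rintro (rfl | hz)
      exacts [SimpleGraph.Walk.end_mem_tail_support hcyc.not_nil, hz]
    rw [h1, List.toFinset_card_of_nodup hcyc.support_nodup, hF,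
      List.toFinset_card_of_nodup hnd, SimpleGraph.Walk.length_edges, List.length_tail,
      SimpleGraph.Walk.length_support]
    rfl
  have hFcard : B.card + (M ∩ F).card = F.card := by
    rw [hB, Finset.inter_comm]
    exact Finset.card_sdiff_add_card_inter F M
  have hcovM : cover (M ∩ F) = S := by
    refine Finset.eq_of_subset_of_card_le (fun z hz => ?_) ?_
    · obtain ⟨e, he, hze⟩ := mem_cover.1 hz
      exact hFS e (Finset.mem_inter.1 he).2 z hze
    · rw [(h.matching_left.subset Finset.inter_subset_left).card_cover]
      omega
  have hMS : ∀ z ∈ S, ∃ m ∈ M, m ∈ F ∧ z ∈ m := by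
    intro z hz
    rw [← hcovM, mem_cover] at hz
    obtain ⟨m, hm, hzm⟩ := hz
    rw [Finset.mem_inter] at hm
    exact ⟨m, hm.1, hm.2, hzm⟩
  -- Each vertex has two cycle edges, one of them in `M`, so only one is left for `B`.
  have hBm : IsMatching G B := by
    refine ⟨fun e he => hFG e (Finset.mem_sdiff.1 he).1, fun e he f hf z hze hzf => ?_⟩
    rw [hB, Finset.mem_sdiff] at he hf
    obtain ⟨m, hm, hmF, hzm⟩ := hMS z (hFS e he.1 z hze)
    refine cycle_edge_unique hcyc (List.mem_toFinset.1 he.1) (List.mem_toFinset.1 hf.1)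
      (List.mem_toFinset.1 hmF) hze hzf hzm ?_ ?_
    · rintro rfl
      exact he.2 hm
    · rintro rfl
      exact hf.2 hm
  have hcovB : cover B = S := by
    refine Finset.eq_of_subset_of_card_le (fun z hz => ?_) ?_
    · obtain ⟨e, he, hze⟩ := mem_cover.1 hz
      exact hFS e (Finset.mem_sdiff.1 he).1 z hze
    · rw [hBm.card_cover]
      omega
  have hBH : B ⊆ H ∪ H' := by
    intro e he
    rw [hB, Finset.mem_sdiff] at he
    have h1 := hFG e he.1
    rw [hc] at h1
    simp only [Set.mem_union, Finset.mem_coe] at h1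
    rw [Finset.mem_union]
    tauto
  have hMFS : ∀ e ∈ M, ∀ z ∈ e, z ∈ S → e ∈ F := by
    intro e he z hze hzS
    obtain ⟨m, hm, hmF, hzm⟩ := hMS z hzS
    rwa [h.matching_left.eq_of_mem he hm hze hzm]
  have hSM : IsClosedUnder S M := fun e he x hx y hy hxS => hFS e (hMFS e he x hx hxS) y hy
  have hMS' : M ∩ S.sym2 = M ∩ F := by
    ext e
    rw [Finset.mem_inter, Finset.mem_inter, Finset.mem_sym2_iff]
    refine and_congr_right fun he => ⟨fun hS => ?_, fun heF z hz => hFS e heF z hz⟩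
    exact hMFS e he _ (Sym2.out_fst_mem e) (hS _ (Sym2.out_fst_mem e))
  have hBS : B ∩ S.sym2 = B := Finset.inter_eq_left.2 fun e he =>
    Finset.mem_sym2_iff.2 fun z hz => hFS e (Finset.mem_sdiff.1 he).1 z hz
  have hMH := h.inter_subset_union hBm hBH hSM (by rw [hMS', hBS, hMB])
  rw [hMS'] at hMH
  have key : ∀ z ∈ S, ∃ p ∈ H, ∃ q ∈ H', p ∈ F ∧ q ∈ F ∧ z ∈ p ∧ z ∈ q := by
    intro z hz
    obtain ⟨m, hm, hmF, hzm⟩ := hMS z hz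
    rw [← hcovB] at hz
    obtain ⟨b, hb, hzb⟩ := mem_cover.1 hz
    have hbF := Finset.mem_sdiff.1 hb
    have hne : m ≠ b := by
      rintro rfl
      exact hbF.2 hm
    rcases Finset.mem_union.1 (hMH (Finset.mem_inter.2 ⟨hm, hmF⟩)) with h1 | h1 <;>
      rcases Finset.mem_union.1 (hBH hb) with h2 | h2
    · exact absurd (h.matching_mid.eq_of_mem h1 h2 hzm hzb) hne
    · exact ⟨m, h1, b, h2, hmF, hbF.1, hzm, hzb⟩
    · exact ⟨b, h2, m, h1, hbF.1, hmF, hzb, hzm⟩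
    · exact absurd (h.matching_right.eq_of_mem h1 h2 hzm hzb) hne
  have huniv : S = Finset.univ := by
    refine eq_univ_of_closed hconn hc ⟨a, by simp [hS]⟩ hSM ?_ ?_
    · intro e he x hx y hy hxS
      obtain ⟨p, hp, -, -, hpF, -, hxp, -⟩ := key x hxS
      rw [h.matching_mid.eq_of_mem he hp hx hxp] at hy
      exact hFS p hpF y hy
    · intro e he x hx y hy hxS
      obtain ⟨-, -, q, hq, -, hqF, -, hxq⟩ := key x hxS
      rw [h.matching_right.eq_of_mem he hq hx hxq] at hy
      exact hFS q hqF y hy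
  refine h.cover_mid_ne_univ hlt (Finset.eq_univ_of_forall fun z => ?_)
  obtain ⟨p, hp, -, -, -, -, hzp, -⟩ := key z (huniv ▸ Finset.mem_univ z)
  exact mem_cover.2 ⟨p, hp, hzp⟩

theorem isSkeletonWitness (h : IsMaximallyIntersecting G M H H') (hc : Covers G M H H')
    (hconn : G.Connected) (hlt : mu G < nu G) :
    IsSkeletonWitness G (alternatingUnion G (M : Set (Sym2 V)) H) := by
  have hK := h.isPathSystem
  have hcM : ∀ x, x ∈ cover M := fun x => h.cover_left_eq_univ hc hconn hlt ▸ Finset.mem_univ x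
  have hnH : ∀ x, x ∈ (alternatingUnion G (M : Set (Sym2 V)) H).verts → x ∉ cover (H \ M) →
      x ∉ cover H := fun x hx hxH =>
    notMem_cover_of_sdiff h.matching_left ((hK.verts x).1 hx) hxH
  refine ⟨?_, ?_, ?_, ?_, ?_, ?_, ?_, h.poorPart_isBipartite hc, ?_⟩
  · intro x hx
    obtain ⟨u, v, p, hxp, hp, hodd, hu, hv, -, -⟩ := hK.exists_path hx
    refine ⟨u, v, p, hp, hxp, hodd, h.five_le_length hp hodd,
      h.degree_eq_one hc (hcM u) (hnH u ?_ hu), h.degree_eq_one hc (hcM v) (hnH v ?_ hv)⟩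
    · exact hp.2.1.1 (SimpleGraph.Walk.start_mem_verts_toSubgraph p)
    · exact hp.2.1.1 (SimpleGraph.Walk.end_mem_verts_toSubgraph p)
  · intro e he
    rw [hK.oddEdges_eq, Finset.mem_coe, Finset.mem_sdiff] at he
    by_cases heU : e ∈ H ∪ H'
    · refine Or.inr fun x hx => ?_
      have := h.degree_le_two hc he.1 heU hx
      omega
    · exact Or.inl fun x hx => h.degree_eq_three hc he.1 heU hx
  · intro u v p hp
    obtain ⟨e, hep, heM, he⟩ := h.exists_edge_notMem hp
    exact ⟨_, SimpleGraph.Walk.mem_support_of_mem_edges hep (Sym2.out_fst_mem e),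
      h.degree_eq_three hc heM he (Sym2.out_fst_mem e)⟩
  · intro x hx
    rw [hK.verts] at hx
    obtain ⟨e, he, hxe⟩ := mem_cover.1 (hcM x)
    refine h.degree_le_two hc he (Finset.mem_union_left _ ?_) hxe
    by_contra heH
    exact hx (mem_cover.2 ⟨e, Finset.mem_sdiff.2 ⟨he, heH⟩, hxe⟩)
  · intro x hx
    obtain ⟨u, v, p, hxp, hp, hodd, -⟩ :=
      (h.isPathSystem_complementPart hc hconn hlt).exists_path hx
    exact ⟨u, v, p, hp, hxp, hodd⟩
  · intro x hx
    obtain ⟨hxK, hxH⟩ := hK.isEndVertex_iff.1 hx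
    exact h.end_vertex_even hc (hnH x hxK hxH)
  · intro a b q hq heven
    exact h.even_path_end hc hconn hlt hq heven
  · intro a c
    rw [h.skeletonMatching_eq hc hconn hlt]
    exact h.not_isAlternatingCycle hc hconn hlt c

/-! ### Number of paths and independence of the chosen triple -/

theorem card_connectedComponent (h : IsMaximallyIntersecting G M H H') :
    Nat.card (alternatingUnion G (M : Set (Sym2 V)) H).coe.ConnectedComponent =
      nu G - mu G := by
  rw [h.isPathSystem.card_connectedComponent, ← h.card_left, ← h.card_mid]
  have h1 := Finset.card_sdiff_add_card_inter M H
  have h2 := Finset.card_sdiff_add_card_inter H M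
  rw [Finset.inter_comm] at h2
  omega

theorem card_union (h : IsMaximallyIntersecting G M H H') :
    (M ∪ (H ∪ H')).card + (M ∩ (H ∪ H')).card = nu G + lam G := by
  rw [Finset.card_union_add_card_inter, h.card_left, Finset.card_union_of_disjoint h.disjoint,
    h.1.1.2.1.2]

theorem covers_iff (h : IsMaximallyIntersecting G M H H') :
    Covers G M H H' ↔ G.edgeFinset.card ≤ (M ∪ (H ∪ H')).card := by
  have hsub : M ∪ (H ∪ H') ⊆ G.edgeFinset := by
    intro e he
    rw [SimpleGraph.mem_edgeFinset]
    rw [Finset.mem_union, Finset.mem_union] at he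
    rcases he with he | he | he
    exacts [h.matching_left.1 e he, h.matching_mid.1 e he, h.matching_right.1 e he]
  have h1 : Covers G M H H' ↔ G.edgeFinset = M ∪ (H ∪ H') := by
    rw [Covers, ← Finset.coe_inj, SimpleGraph.coe_edgeFinset]
    push_cast
    rw [Set.union_assoc]
  rw [h1]
  constructor
  · intro he
    rw [he]
  · intro hle
    exact (Finset.eq_of_subset_of_card_le hsub hle).symm

/-- The union of a triple has size `ν + λ` minus its intersection, and the intersection for `(M, H,
H')` is maximal, so no admissible triple has a smaller union. -/
theorem covers_of_covers (h : IsMaximallyIntersecting G M H H') (hc : Covers G M H H')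
    {N K K' : Finset (Sym2 V)} (hN : IsMaximallyIntersecting G N K K') : Covers G N K K' := by
  rw [h.covers_iff] at hc
  rw [hN.covers_iff]
  have h1 := h.card_union
  have h2 := hN.card_union
  have h3 := h.1.2 _ _ _ hN.1.1
  omega

end IsMaximallyIntersecting
end Degrees
end DisjointMatchings

theorem mainTheorem1 {V : Type*} [Fintype V] [DecidableEq V] (G : SimpleGraph V)
    [DecidableRel G.Adj] (hconn : G.Connected) (hpos : 0 < DisjointMatchings.nu G)
    (hratio : (DisjointMatchings.mu G : ℚ) / (DisjointMatchings.nu G : ℚ) < 1) :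
    ((∃ M H H' : Finset (Sym2 V), DisjointMatchings.IsMaximallyIntersecting G M H H' ∧
        DisjointMatchings.Covers G M H H') ↔
      (∀ M H H' : Finset (Sym2 V), DisjointMatchings.IsMaximallyIntersecting G M H H' →
        DisjointMatchings.Covers G M H H')) ∧
    ((∃ M H H' : Finset (Sym2 V), DisjointMatchings.IsMaximallyIntersecting G M H H' ∧
        DisjointMatchings.Covers G M H H') →
      DisjointMatchings.IsSkeleton G ∧
      DisjointMatchings.IsKSkeleton G (DisjointMatchings.nu G - DisjointMatchings.mu G) ∧
      ∀ M H H' : Finset (Sym2 V), DisjointMatchings.IsMaximallyIntersecting G M H H' →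
        DisjointMatchings.IsSkeletonWitness G (DisjointMatchings.alternatingUnion G M H) ∧
        Nat.card (DisjointMatchings.alternatingUnion G M H).coe.ConnectedComponent =
          DisjointMatchings.nu G - DisjointMatchings.mu G) := by
  have hlt : DisjointMatchings.mu G < DisjointMatchings.nu G := by
    -- With `ν = 0` the quotient would be `0` by convention and the hypothesis would say nothing.
    rw [div_lt_one (by exact_mod_cast hpos)] at hratio
    exact_mod_cast hratio
  refine ⟨⟨?_, ?_⟩, ?_⟩
  · rintro ⟨M, H, H', h, hc⟩ N K K' hN
    exact h.covers_of_covers hc hN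
  · intro hall
    -- Existence of a maximally intersecting triple keeps the universal statement from being
    -- vacuous.
    obtain ⟨M, H, H', h⟩ := DisjointMatchings.exists_isMaximallyIntersecting G
    exact ⟨M, H, H', h, hall M H H' h⟩
  · rintro ⟨M, H, H', h, hc⟩
    have hW := h.isSkeletonWitness hc hconn hlt
    exact ⟨⟨hconn, h.degree_le_three hc, _, hW⟩,
      ⟨hconn, h.degree_le_three hc, _, hW, h.card_connectedComponent⟩, fun N K K' hN =>
      ⟨hN.isSkeletonWitness (h.covers_of_covers hc hN) hconn hlt, hN.card_connectedComponent⟩⟩
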